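/- Let $G=(V,E,\mu,\mathbf w)$ be a submodular hypergraph: $V=\{1,\dots,N\}$, $E\subseteq 2^V$, vertex weights $\mu_v>0$, and for each $e\in E$ a scale $\vartheta_e>0$ and a weight function $w_e:2^e\to[0,1]$ that is submodular, symmetric ($w_e(S)=w_e(e\setminus S)$) and satisfies $w_e(\emptyset)=0$. Let $f_e:\mathbb R^N\to\mathbb R$ be the Lovász extension of $S\mapsto w_e(S\cap e)$, that is, $f_e(x)=\sum_{j=1}^{N-1}w_e(\{i_1,\dots,i_j\}\cap e)(x_{i_j}-x_{i_{j+1}})$ whenever $x_{i_1}\ge\dots\ge x_{i_N}$. For real $p\ge1$ put $$Q_p(x)=\sum_{e\in E}\vartheta_e f_e(x)^p,\quad \|x\|_{\ell_p,\mu}=\Big(\sum_v\mu_v|x_v|^p\Big)^{1/p},\quad S_{p,\mu}=\{x\in\mathbb R^N:\|x\|_{\ell_p,\mu}=1\},\quad R_p(x)=\frac{Q_p(x)}{\|x\|_{\ell_p,\mu}^p},$$ $$\triangle_p(x)=\sum_{e\in E}\vartheta_e f_e(x)^{p-1}\,\nabla f_e(x)$$ (a Minkowski sum, where $\nabla$ of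 a convex function is its subdifferential and $f_e(x)^{0}=1$). Let $\varphi_p(x)$ be the set of all $y$ with $y_v\in|x_v|^{p-1}\operatorname{sgn}(x_v)$ for every $v$, where $\operatorname{sgn}(a)=\{\pm1\}$ according to the sign of $a\ne0$, $\operatorname{sgn}(0)=[-1,1]$ and $|0|^0=1$, and let $U=\operatorname{diag}(\mu_1,\dots,\mu_N)$. A pair $(\lambda,x)$ with $\lambda\in\mathbb R$, $x\in\mathbb R^N\setminus\{0\}$, is an *eigenpair* of $\triangle_p$ if $\triangle_p(x)\cap\lambda U\varphi_p(x)\neq\emptyset$. A point $x\in S_{p,\mu}$ is a *critical point* of $\tilde Q_p=Q_p|_{S_{p,\mu}}$, with critical value $\tilde Q_p(x)$, if there is $\sigma\in\nabla Q_p(x)$ whose Euclidean metric projection onto the (Bouligand) tangent cone of $S_{p,\mu}$ at $x$ (the tangent space when $p>1$) is $0$. A point $x\in S_{p,\mu}$ is a *critical point* of $R_p$, with critical value $R_p(x)$, if $0$ belongs to the Clarke generalized gradient of $R_p$ at $x$. **Theorem.** Let $\lambda\in\mathbb R$ and $x\in S_{p,\mu}$. 1. For $p\ge1$: $(\lambda,x)$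 is an eigenpair of $\triangle_p$ if and only if $x$ is a critical point of $\tilde Q_p$ with critical value $\lambda$. 2. For $p>1$: $(\lambda,x)$ is an eigenpair of $\triangle_p$ if and only if $x$ is a critical point of $R_p$ with critical value $\lambda$. 3. For $p=1$: if $x$ is a critical point of $R_1$ with critical value $\lambda$, then $(\lambda,x)$ is an eigenpair of $\triangle_1$. The converse fails in general: there are a submodular hypergraph, which can be taken with $\max_{S\subseteq e}w_e(S)=1$ and $w_e(\{v\})>0$ for all $v\in e\in E$, and an eigenpair $(\lambda,x)$ of its $\triangle_1$ with $x\in S_{1,\mu}$, such that $x$ is not a critical point of $R_1$. -/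

import Mathlib

open Filter Topology

noncomputable section

/-- `ℝ^N` with its standard inner product. -/
abbrev Vec (N : ℕ) : Type := EuclideanSpace ℝ (Fin N)

/-! ### Lovász extension -/

/-- The sum `∑_{j=1}^{N-1} F({i_1, …, i_j}) (x_{i_j} - x_{i_{j+1}})` for the enumeration
`i_1, …, i_N` of the vertices given by the permutation `σ`. -/
def lovaszSum {N : ℕ} (F : Finset (Fin N) → ℝ) (x : Vec N) (σ : Equiv.Perm (Fin N)) : ℝ :=
  ∑ j : Fin N, if h : (j : ℕ) + 1 < N then
    F ((Finset.Iic j).image σ) * (x (σ j) - x (σ ⟨(j : ℕ) + 1, h⟩)) else 0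

/-- The Lovász extension of a set function `F`: the sum above for an enumeration that puts the
entries of `x` in nonincreasing order. The choice of the enumeration does not matter,
see `lovaszSum_eq_lovasz`. -/
def lovasz {N : ℕ} (F : Finset (Fin N) → ℝ) (x : Vec N) : ℝ :=
  lovaszSum F x (Tuple.sort fun i => -x i)

theorem image_Iic_eq_superlevel {N : ℕ} {x : Vec N} {σ : Equiv.Perm (Fin N)}
    (hσ : Antitone fun j => x (σ j)) (j : Fin N) (h : (j : ℕ) + 1 < N)
    (hne : x (σ j) ≠ x (σ ⟨(j : ℕ) + 1, h⟩)) :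
    (Finset.Iic j).image σ = Finset.univ.filter fun v => x (σ j) ≤ x v := by
  ext v
  simp only [Finset.mem_image, Finset.mem_Iic, Finset.mem_filter, Finset.mem_univ, true_and]
  constructor
  · rintro ⟨i, hi, rfl⟩
    exact hσ hi
  · intro hv
    refine ⟨σ.symm v, ?_, by simp⟩
    by_contra hlt
    have h1 : (⟨(j : ℕ) + 1, h⟩ : Fin N) ≤ σ.symm v := by
      rw [not_le] at hlt
      exact Fin.mk_le_of_le_val hlt
    have h2 := hσ h1
    have h3 : x (σ ⟨(j : ℕ) + 1, h⟩) ≤ x (σ j) :=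
      hσ (show j ≤ ⟨(j : ℕ) + 1, h⟩ from Fin.le_def.2 (Nat.le_succ _))
    simp only [Equiv.apply_symm_apply] at h2
    exact hne (le_antisymm (hv.trans h2) h3)

/-- Ties may be broken arbitrarily. -/
theorem lovaszSum_eq_lovasz {N : ℕ} (F : Finset (Fin N) → ℝ) (x : Vec N)
    (σ : Equiv.Perm (Fin N)) (hσ : Antitone fun j => x (σ j)) :
    lovaszSum F x σ = lovasz F x := by
  set τ : Equiv.Perm (Fin N) := Tuple.sort fun i => -x i with hτdef
  have hτ : Antitone fun j => x (τ j) := by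
    intro a b hab
    have := Tuple.monotone_sort (fun i => -x i) hab
    simpa using this
  have key : (fun i => x i) ∘ σ = (fun i => x i) ∘ τ :=
    Tuple.unique_antitone hσ hτ
  have hk : ∀ j, x (σ j) = x (τ j) := fun j => congrFun key j
  unfold lovasz lovaszSum
  refine Finset.sum_congr rfl fun j _ => ?_
  split_ifs with h
  · rw [← hτdef]
    by_cases hne : x (σ j) = x (σ ⟨(j : ℕ) + 1, h⟩)
    · rw [← hk, ← hk, hne]; simp
    · have hne' : x (τ j) ≠ x (τ ⟨(j : ℕ) + 1, h⟩) := by rwa [← hk, ← hk]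
      rw [image_Iic_eq_superlevel hσ j h hne, image_Iic_eq_superlevel hτ j h hne', hk, hk]
  · rfl

/-! ### Generalized gradients, projections -/

/-- The subdifferential of a (convex) function on `ℝ^N`. -/
def subdiff {N : ℕ} (f : Vec N → ℝ) (x : Vec N) : Set (Vec N) :=
  {y | ∀ x', inner ℝ y (x' - x) ≤ f x' - f x}

/-- Clarke's generalized directional derivative
`f°(x; v) = limsup_{y → x, t ↓ 0} (f (y + t v) - f y) / t`, with values in `[-∞, ∞]`. -/
def clarkeDeriv {N : ℕ} (f : Vec N → ℝ) (x v : Vec N) : EReal :=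
  limsup (fun q : Vec N × ℝ => (((f (q.1 + q.2 • v) - f q.1) / q.2 : ℝ) : EReal))
    (𝓝 x ×ˢ 𝓝[>] (0 : ℝ))

/-- Clarke's generalized gradient of a function that is Lipschitz near `x`. -/
def clarkeSubdiff {N : ℕ} (f : Vec N → ℝ) (x : Vec N) : Set (Vec N) :=
  {y | ∀ v, ((inner ℝ y v : ℝ) : EReal) ≤ clarkeDeriv f x v}

/-- The metric projection onto `T`: the set of points of `T` nearest to `y`. If `T` is a linear
subspace it consists of the orthogonal projection of `y` only. -/
def metricProj {N : ℕ} (T : Set (Vec N)) (y : Vec N) : Set (Vec N) :=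
  {z | z ∈ T ∧ ∀ d ∈ T, dist y z ≤ dist y d}

/-! ### Submodular hypergraphs -/

/-- A submodular hypergraph on the vertex set `Fin N`. The weight function `w e` of a hyperedge
`e` matters on subsets of `e` only. -/
structure SubmodularHypergraph (N : ℕ) where
  /-- the hyperedges -/
  edges : Finset (Finset (Fin N))
  /-- the vertex weights -/
  μ : Fin N → ℝ
  /-- the hyperedge scaling factors -/
  ϑ : Finset (Fin N) → ℝ
  /-- the normalized hyperedge weight functions -/
  w : Finset (Fin N) → Finset (Fin N) → ℝ
  μ_pos : ∀ v, 0 < μ v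
  ϑ_pos : ∀ e ∈ edges, 0 < ϑ e
  w_mem : ∀ e ∈ edges, ∀ S ⊆ e, w e S ∈ Set.Icc (0 : ℝ) 1
  w_empty : ∀ e ∈ edges, w e ∅ = 0
  w_symm : ∀ e ∈ edges, ∀ S ⊆ e, w e (e \ S) = w e S
  w_submodular : ∀ e ∈ edges, ∀ S ⊆ e, ∀ T ⊆ e, w e (S ∪ T) + w e (S ∩ T) ≤ w e S + w e T

namespace SubmodularHypergraph

variable {N : ℕ} (G : SubmodularHypergraph N)

/-- Every weight function attains the value `1`, and every vertex of a hyperedge is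
incident to it. -/
def IsProper : Prop :=
  ∀ e ∈ G.edges, (∃ S ⊆ e, G.w e S = 1) ∧ ∀ v ∈ e, 0 < G.w e {v}

/-- The Lovász extension `f_e` of `S ↦ w_e (S ∩ e)`. -/
def f (e : Finset (Fin N)) : Vec N → ℝ :=
  lovasz fun S => G.w e (S ∩ e)

/-- `Q_p(x) = ∑_e ϑ_e f_e(x)^p`. -/
def Q (p : ℝ) (x : Vec N) : ℝ :=
  ∑ e ∈ G.edges, G.ϑ e * G.f e x ^ p

/-- The weighted norm `(∑_v μ_v |x_v|^p)^{1/p}`. -/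
def lpNorm (p : ℝ) (x : Vec N) : ℝ :=
  (∑ v, G.μ v * |x v| ^ p) ^ (1 / p)

/-- The unit sphere `S_{p,μ}`. -/
def sphere (p : ℝ) : Set (Vec N) :=
  {x | G.lpNorm p x = 1}

/-- The Rayleigh quotient `R_p`. -/
def R (p : ℝ) (x : Vec N) : ℝ :=
  G.Q p x / G.lpNorm p x ^ p

/-- The `p`-Laplacian, the set `∑_e ϑ_e f_e(x)^{p-1} ∇f_e(x)` (a Minkowski sum). For `p = 1` the
factor `f_e(x)^{p-1}` is `1`, also where `f_e(x) = 0`. -/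
def laplacian (p : ℝ) (x : Vec N) : Set (Vec N) :=
  {y | ∃ g : Finset (Fin N) → Vec N, (∀ e ∈ G.edges, g e ∈ subdiff (G.f e) x) ∧
    y = ∑ e ∈ G.edges, (G.ϑ e * G.f e x ^ (p - 1)) • g e}

end SubmodularHypergraph

/-- The set-valued sign: `{1}`, `{-1}` or `[-1, 1]`. -/
def sgnSet (a : ℝ) : Set ℝ :=
  if 0 < a then {1} else if a < 0 then {-1} else Set.Icc (-1) 1

/-- The set-valued `φ_p`, with coordinates `|x_v|^{p-1} sgn(x_v)`. -/
def phi {N : ℕ} (p : ℝ) (x : Vec N) : Set (Vec N) :=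
  {y | ∀ v, ∃ s ∈ sgnSet (x v), y v = |x v| ^ (p - 1) * s}

namespace SubmodularHypergraph

variable {N : ℕ} (G : SubmodularHypergraph N)

/-- The set `λ U φ_p(x)`, where `U` is the diagonal matrix of the vertex weights. -/
def scaledPhi (lam p : ℝ) (x : Vec N) : Set (Vec N) :=
  {y | ∃ z ∈ phi p x, ∀ v, y v = lam * (G.μ v * z v)}

/-- `(λ, x)` is an eigenpair of the `p`-Laplacian. -/
def IsEigenpair (p lam : ℝ) (x : Vec N) : Prop :=
  x ≠ 0 ∧ (G.laplacian p x ∩ G.scaledPhi lam p x).Nonempty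

/-- `x` is a critical point of `Q_p` restricted to the sphere `S_{p,μ}`: some subgradient of `Q_p`
at `x` has projection zero onto the tangent cone of the sphere at `x` (for `p > 1`, the tangent
space). -/
def IsCriticalQ (p : ℝ) (x : Vec N) : Prop :=
  x ∈ G.sphere p ∧
    ∃ y ∈ subdiff (G.Q p) x, metricProj (posTangentConeAt (G.sphere p) x) y = {0}

/-- `x` is a critical point of the Rayleigh quotient `R_p`. -/
def IsCriticalR (p : ℝ) (x : Vec N) : Prop :=
  x ∈ G.sphere p ∧ 0 ∈ clarkeSubdiff (G.R p) x

end SubmodularHypergraph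

end

/-! All three notions reduce to one inequality between directional derivatives. The Lovász extension
of a submodular function is a maximum of linear forms, so each `f e` is convex, nonnegative and
positively homogeneous. Hence `Q p` is convex, its subdifferential is `p` times the Laplacian, and
Euler's identity gives `inner y x = Q p x` for `y` in the Laplacian. Let `massDir` be the one-sided
derivative of `mass p / p` at `x`. For `k ≥ 0`, `scaledPhi k p x` consists of the `y` with `inner y
d ≤ k * massDir d` for all `d`. Pairing with `x` forces `lam = Q p x ≥ 0`, so `(lam, x)` is an
eigenpair iff `Q p x = lam` and some `y` in `subdiff (Q p) x` satisfies `inner y d ≤ p * lam *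
massDir d` for all `d` (`isEigenpair_iff`).

For the sphere, the tangent cone is `massDir = 0`, and a projection onto a cone is zero iff the
vector is polar to it. As `massDir` is additive in radial directions, every `d` can be corrected
radially into the cone; Euler's identity then turns polarity into the inequality.

For the Rayleigh quotient, convexity bounds the Clarke derivative so that criticality makes `x` a
minimizer of `Q p z + Q p x * mass p (2x - z)`. The reflection appears because `mass` sits in the
denominator. Separation yields opposite subgradients of the two terms, which is the inequality
again. If `p > 1`, `massDir` is odd, so the inequality can be reversed, giving criticality of `R p`.
If `p = 1`, oddness fails at zero coordinates, and a weighted path has an eigenvector along which `R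
1` has a direction of strict descent. -/

noncomputable section

/-! ### Lovász extensions as maxima of greedy linear forms -/

section Lovasz

variable {N : ℕ}

theorem sum_prefix_mul_sub (M : ℕ) (a z : ℕ → ℝ) :
    ∑ j ∈ Finset.range M, (∑ i ∈ Finset.range (j + 1), a i) * (z j - z (j + 1)) =
      ∑ i ∈ Finset.range (M + 1), a i * z i - (∑ i ∈ Finset.range (M + 1), a i) * z M := by
  induction M with
  | zero => simp
  | succ M ih =>
    rw [Finset.sum_range_succ, ih, Finset.sum_range_succ _ (M + 1),
      Finset.sum_range_succ _ (M + 1)]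
    ring

/-- Prefixes that end inside a tie have coefficient zero. -/
theorem lovaszSum_congr {F F' : Finset (Fin N) → ℝ} {x : Vec N} {σ : Equiv.Perm (Fin N)}
    (h : ∀ (j : Fin N) (hj : (j : ℕ) + 1 < N), x (σ j) ≠ x (σ ⟨(j : ℕ) + 1, hj⟩) →
      F ((Finset.Iic j).image σ) = F' ((Finset.Iic j).image σ)) :
    lovaszSum F x σ = lovaszSum F' x σ := by
  unfold lovaszSum
  refine Finset.sum_congr rfl fun j _ => ?_
  split_ifs with hj
  · by_cases hx : x (σ j) = x (σ ⟨(j : ℕ) + 1, hj⟩)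
    · simp [hx]
    · rw [h j hj hx]
  · rfl

theorem lovaszSum_mono {F F' : Finset (Fin N) → ℝ} {x : Vec N} {σ : Equiv.Perm (Fin N)}
    (hσ : Antitone fun j => x (σ j)) (h : ∀ S, F S ≤ F' S) :
    lovaszSum F x σ ≤ lovaszSum F' x σ := by
  unfold lovaszSum
  refine Finset.sum_le_sum fun j _ => ?_
  split_ifs with hj
  · have : x (σ ⟨(j : ℕ) + 1, hj⟩) ≤ x (σ j) :=
      hσ (show j ≤ ⟨(j : ℕ) + 1, hj⟩ from Fin.le_def.2 (Nat.le_succ _))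
    exact mul_le_mul_of_nonneg_right (h _) (by linarith)
  · exact le_rfl

/-- The Lovász sum of a modular function of total mass zero is linear. -/
theorem lovaszSum_modular (m : Fin N → ℝ) (hm : ∑ v, m v = 0) (x : Vec N)
    (σ : Equiv.Perm (Fin N)) :
    lovaszSum (fun S => ∑ v ∈ S, m v) x σ = ∑ v, m v * x v := by
  obtain _ | M := N
  · simp [lovaszSum]
  set a : ℕ → ℝ := fun i => if h : i < M + 1 then m (σ ⟨i, h⟩) else 0 with ha
  set z : ℕ → ℝ := fun i => if h : i < M + 1 then x (σ ⟨i, h⟩) else 0 with hz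
  have hav : ∀ i : Fin (M + 1), a i = m (σ i) := fun i => dif_pos i.2
  have hzv : ∀ i : Fin (M + 1), z i = x (σ i) := fun i => dif_pos i.2
  have hpre : ∀ j : Fin (M + 1), ∑ v ∈ (Finset.Iic j).image σ, m v =
      ∑ i ∈ Finset.range ((j : ℕ) + 1), a i := by
    intro j
    rw [Finset.sum_image (fun _ _ _ _ h => σ.injective h)]
    refine Finset.sum_bij (fun i _ => (i : ℕ)) ?_ ?_ ?_ ?_
    · intro i hi
      have := Fin.le_def.1 (Finset.mem_Iic.1 hi)
      simpa using Nat.lt_succ_of_le this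
    · intro i _ i' _ h
      exact Fin.ext h
    · intro b hb
      have hb' : b < (j : ℕ) + 1 := by simpa using hb
      refine ⟨⟨b, by omega⟩, ?_, rfl⟩
      simp [Fin.le_def]; omega
    · intro i _
      exact (hav i).symm
  have htot : ∑ i ∈ Finset.range (M + 1), a i = 0 := by
    rw [Finset.sum_range, ← hm, ← Equiv.sum_comp σ m]
    exact Finset.sum_congr rfl fun i _ => hav i
  have hmz : ∑ i ∈ Finset.range (M + 1), a i * z i = ∑ v, m v * x v := by
    rw [Finset.sum_range, ← Equiv.sum_comp σ fun v => m v * x v]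
    exact Finset.sum_congr rfl fun i _ => by rw [hav i, hzv i]
  have key := sum_prefix_mul_sub M a z
  rw [htot, hmz, zero_mul, sub_zero] at key
  rw [← key, ← Fin.sum_univ_eq_sum_range
    (fun j => (∑ i ∈ Finset.range (j + 1), a i) * (z j - z (j + 1))) M]
  unfold lovaszSum
  rw [Fin.sum_univ_castSucc, dif_neg (by simp), add_zero]
  refine Finset.sum_congr rfl fun j _ => ?_
  have hj : ((Fin.castSucc j : Fin (M + 1)) : ℕ) + 1 < M + 1 := by simp
  rw [dif_pos hj]
  beta_reduce
  rw [hpre, ← hzv, ← hzv]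
  rfl

/-- The base polytope vertex produced by the greedy algorithm for the ordering `σ`. -/
def greedy (F : Finset (Fin N) → ℝ) (σ : Equiv.Perm (Fin N)) (v : Fin N) : ℝ :=
  F ((Finset.Iic (σ.symm v)).image σ) - F ((Finset.Iio (σ.symm v)).image σ)

theorem greedy_prefix {F : Finset (Fin N) → ℝ} (h0 : F ∅ = 0) (σ : Equiv.Perm (Fin N)) (k : ℕ) :
    ∑ v with ((σ.symm v : Fin N) : ℕ) < k, greedy F σ v =
      F (Finset.univ.filter fun v => ((σ.symm v : Fin N) : ℕ) < k) := by
  induction k with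
  | zero => simp [h0]
  | succ k ih =>
    by_cases hk : k < N
    · have hins : (Finset.univ.filter fun v => ((σ.symm v : Fin N) : ℕ) < k + 1) =
          insert (σ ⟨k, hk⟩) (Finset.univ.filter fun v => ((σ.symm v : Fin N) : ℕ) < k) := by
        ext v
        simp only [Finset.mem_filter, Finset.mem_univ, true_and, Finset.mem_insert,
          ← Equiv.symm_apply_eq, Fin.ext_iff]
        omega
      have h1 : (Finset.Iic (⟨k, hk⟩ : Fin N)).image σ =
          Finset.univ.filter fun v => ((σ.symm v : Fin N) : ℕ) < k + 1 := by
        ext v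
        simp only [Finset.mem_image, Finset.mem_Iic, Finset.mem_filter, Finset.mem_univ, true_and,
          Fin.le_def]
        exact ⟨by rintro ⟨i, hi, rfl⟩; simpa using Nat.lt_succ_of_le hi,
          fun h => ⟨σ.symm v, Nat.le_of_lt_succ h, by simp⟩⟩
      have h2 : (Finset.Iio (⟨k, hk⟩ : Fin N)).image σ =
          Finset.univ.filter fun v => ((σ.symm v : Fin N) : ℕ) < k := by
        ext v
        simp only [Finset.mem_image, Finset.mem_Iio, Finset.mem_filter, Finset.mem_univ, true_and,
          Fin.lt_def]
        exact ⟨by rintro ⟨i, hi, rfl⟩; simpa using hi, fun h => ⟨σ.symm v, h, by simp⟩⟩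
      have hg : greedy F σ (σ ⟨k, hk⟩) =
          F (Finset.univ.filter fun v => ((σ.symm v : Fin N) : ℕ) < k + 1) -
          F (Finset.univ.filter fun v => ((σ.symm v : Fin N) : ℕ) < k) := by
        rw [greedy, Equiv.symm_apply_apply, h1, h2]
      rw [hins, Finset.sum_insert (by simp), ih, hg, ← hins]
      ring
    · have : (Finset.univ.filter fun v => ((σ.symm v : Fin N) : ℕ) < k + 1) =
          Finset.univ.filter fun v => ((σ.symm v : Fin N) : ℕ) < k := by
        ext v
        have := (σ.symm v).2
        simp only [Finset.mem_filter, Finset.mem_univ, true_and]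
        omega
      rw [this, ih]

/-- Diminishing returns: adding a vertex to the part of `S` preceding it gains at least as much as
adding it to the whole prefix, and the latter gain is its greedy value. -/
theorem greedy_le {F : Finset (Fin N) → ℝ} (h0 : F ∅ = 0)
    (hF : ∀ S T, F (S ∪ T) + F (S ∩ T) ≤ F S + F T) (σ : Equiv.Perm (Fin N))
    (S : Finset (Fin N)) : ∑ v ∈ S, greedy F σ v ≤ F S := by
  have key : ∀ k : ℕ, ∑ v ∈ S with ((σ.symm v : Fin N) : ℕ) < k, greedy F σ v ≤
      F (S.filter fun v => ((σ.symm v : Fin N) : ℕ) < k) := by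
    intro k
    induction k with
    | zero => simp [h0]
    | succ k ih =>
      by_cases hk : ∃ v ∈ S, ((σ.symm v : Fin N) : ℕ) = k
      · obtain ⟨v, hvS, hv⟩ := hk
        have huniq : ∀ u, ((σ.symm u : Fin N) : ℕ) = k → u = v := by
          intro u hu
          exact σ.symm.injective (Fin.ext (hu.trans hv.symm))
        have hins : (S.filter fun v => ((σ.symm v : Fin N) : ℕ) < k + 1) =
            insert v (S.filter fun v => ((σ.symm v : Fin N) : ℕ) < k) := by
          ext u
          simp only [Finset.mem_filter, Finset.mem_insert]
          constructor
          · rintro ⟨h1, h2⟩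
            rcases Nat.lt_succ_iff_lt_or_eq.1 h2 with h | h
            · exact Or.inr ⟨h1, h⟩
            · exact Or.inl (huniq u h)
          · rintro (rfl | ⟨h1, h2⟩)
            · exact ⟨hvS, by omega⟩
            · exact ⟨h1, by omega⟩
        have hinsU : (Finset.univ.filter fun v => ((σ.symm v : Fin N) : ℕ) < k + 1) =
            insert v (Finset.univ.filter fun v => ((σ.symm v : Fin N) : ℕ) < k) := by
          ext u
          simp only [Finset.mem_filter, Finset.mem_insert, Finset.mem_univ, true_and]
          constructor
          · intro h2
            rcases Nat.lt_succ_iff_lt_or_eq.1 h2 with h | h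
            · exact Or.inr h
            · exact Or.inl (huniq u h)
          · rintro (rfl | h2) <;> omega
        have hnot : v ∉ Finset.univ.filter fun v => ((σ.symm v : Fin N) : ℕ) < k := by
          simp [hv]
        have hg : greedy F σ v =
            F (Finset.univ.filter fun v => ((σ.symm v : Fin N) : ℕ) < k + 1) -
            F (Finset.univ.filter fun v => ((σ.symm v : Fin N) : ℕ) < k) := by
          have := greedy_prefix h0 σ (k + 1)
          rw [hinsU, Finset.sum_insert hnot, greedy_prefix h0, ← hinsU] at this
          linarith
        have hsub := hF (S.filter fun v => ((σ.symm v : Fin N) : ℕ) < k + 1)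
          (Finset.univ.filter fun v => ((σ.symm v : Fin N) : ℕ) < k)
        have hU : (S.filter fun v => ((σ.symm v : Fin N) : ℕ) < k + 1) ∪
            (Finset.univ.filter fun v => ((σ.symm v : Fin N) : ℕ) < k) =
            Finset.univ.filter fun v => ((σ.symm v : Fin N) : ℕ) < k + 1 := by
          rw [hins, hinsU]
          ext u
          simp only [Finset.mem_union, Finset.mem_insert, Finset.mem_filter, Finset.mem_univ,
            true_and]
          tauto
        have hI : (S.filter fun v => ((σ.symm v : Fin N) : ℕ) < k + 1) ∩
            (Finset.univ.filter fun v => ((σ.symm v : Fin N) : ℕ) < k) =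
            S.filter fun v => ((σ.symm v : Fin N) : ℕ) < k := by
          ext u
          simp only [Finset.mem_inter, Finset.mem_filter, Finset.mem_univ, true_and]
          constructor
          · rintro ⟨⟨h1, _⟩, h2⟩; exact ⟨h1, h2⟩
          · rintro ⟨h1, h2⟩; exact ⟨⟨h1, by omega⟩, h2⟩
        rw [hU, hI] at hsub
        have hsum : ∑ v ∈ S with ((σ.symm v : Fin N) : ℕ) < k + 1, greedy F σ v =
            greedy F σ v + ∑ v ∈ S with ((σ.symm v : Fin N) : ℕ) < k, greedy F σ v := by
          rw [hins, Finset.sum_insert (by simp [hv])]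
        rw [hsum]
        linarith
      · have : (S.filter fun v => ((σ.symm v : Fin N) : ℕ) < k + 1) =
            S.filter fun v => ((σ.symm v : Fin N) : ℕ) < k := by
          refine Finset.filter_congr fun u hu => ?_
          have : ((σ.symm u : Fin N) : ℕ) ≠ k := fun h => hk ⟨u, hu, h⟩
          omega
        rw [this]
        exact ih
  have := key N
  rwa [Finset.filter_true_of_mem fun v _ => (σ.symm v).2] at this

theorem sum_greedy {F : Finset (Fin N) → ℝ} (h0 : F ∅ = 0) (h1 : F Finset.univ = 0)
    (σ : Equiv.Perm (Fin N)) : ∑ v, greedy F σ v = 0 := by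
  have := greedy_prefix h0 σ N
  rwa [Finset.filter_true_of_mem fun v _ => (σ.symm v).2, h1] at this

theorem lovaszSum_eq_greedy {F : Finset (Fin N) → ℝ} (h0 : F ∅ = 0) (h1 : F Finset.univ = 0)
    (x : Vec N) (σ : Equiv.Perm (Fin N)) :
    lovaszSum F x σ = ∑ v, greedy F σ v * x v := by
  rw [← lovaszSum_modular _ (sum_greedy h0 h1 σ) x σ]
  refine lovaszSum_congr fun j _ _ => ?_
  have : (Finset.Iic j).image σ =
      Finset.univ.filter fun v => ((σ.symm v : Fin N) : ℕ) < (j : ℕ) + 1 := by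
    ext v
    simp only [Finset.mem_image, Finset.mem_Iic, Finset.mem_filter, Finset.mem_univ, true_and,
      Fin.le_def]
    exact ⟨by rintro ⟨i, hi, rfl⟩; simpa using Nat.lt_succ_of_le hi,
      fun h => ⟨σ.symm v, Nat.le_of_lt_succ h, by simp⟩⟩
  rw [this, greedy_prefix h0]

theorem antitone_sort_neg (x : Vec N) : Antitone fun j => x (Tuple.sort (fun i => -x i) j) := by
  intro a b hab
  simpa using Tuple.monotone_sort (fun i => -x i) hab

/-- The greedy vector of `σ` gives a modular function below `F`; compare the two along the sorted
order of `x`. So `lovasz F` is a maximum of linear forms, which is the source of convexity. -/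
theorem lovaszSum_le_lovasz {F : Finset (Fin N) → ℝ} (h0 : F ∅ = 0) (h1 : F Finset.univ = 0)
    (hF : ∀ S T, F (S ∪ T) + F (S ∩ T) ≤ F S + F T) (x : Vec N) (σ : Equiv.Perm (Fin N)) :
    lovaszSum F x σ ≤ lovasz F x := by
  rw [lovaszSum_eq_greedy h0 h1, ← lovaszSum_modular _ (sum_greedy h0 h1 σ) x]
  exact lovaszSum_mono (antitone_sort_neg x) (greedy_le h0 hF σ)

theorem lovasz_nonneg {F : Finset (Fin N) → ℝ} (hF : ∀ S, 0 ≤ F S) (x : Vec N) :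
    0 ≤ lovasz F x := by
  have := lovaszSum_mono (F := fun _ => 0) (antitone_sort_neg x) hF
  simpa [lovaszSum, lovasz] using this

theorem lovaszSum_add (F : Finset (Fin N) → ℝ) (x y : Vec N) (σ : Equiv.Perm (Fin N)) :
    lovaszSum F (x + y) σ = lovaszSum F x σ + lovaszSum F y σ := by
  unfold lovaszSum
  rw [← Finset.sum_add_distrib]
  refine Finset.sum_congr rfl fun j _ => ?_
  split_ifs
  · simp only [PiLp.add_apply]; ring
  · simp

theorem lovaszSum_smul (F : Finset (Fin N) → ℝ) (c : ℝ) (x : Vec N) (σ : Equiv.Perm (Fin N)) :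
    lovaszSum F (c • x) σ = c * lovaszSum F x σ := by
  unfold lovaszSum
  rw [Finset.mul_sum]
  refine Finset.sum_congr rfl fun j _ => ?_
  split_ifs
  · simp only [PiLp.smul_apply, smul_eq_mul]; ring
  · simp

theorem lovasz_smul (F : Finset (Fin N) → ℝ) {c : ℝ} (hc : 0 ≤ c) (x : Vec N) :
    lovasz F (c • x) = c * lovasz F x := by
  rw [← lovaszSum_eq_lovasz F (c • x) (Tuple.sort fun i => -x i), lovaszSum_smul]
  · rfl
  · intro a b hab
    simpa using mul_le_mul_of_nonneg_left (antitone_sort_neg x hab) hc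

theorem convexOn_lovasz {F : Finset (Fin N) → ℝ} (h0 : F ∅ = 0) (h1 : F Finset.univ = 0)
    (hF : ∀ S T, F (S ∪ T) + F (S ∩ T) ≤ F S + F T) : ConvexOn ℝ Set.univ (lovasz F) := by
  refine ⟨convex_univ, fun x _ y _ a b ha hb _ => ?_⟩
  conv_lhs => rw [lovasz]
  rw [lovaszSum_add, lovaszSum_smul, lovaszSum_smul]
  exact add_le_add (mul_le_mul_of_nonneg_left (lovaszSum_le_lovasz h0 h1 hF x _) ha)
    (mul_le_mul_of_nonneg_left (lovaszSum_le_lovasz h0 h1 hF y _) hb)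

end Lovasz

/-! ### Convexity and homogeneity of `f e` -/

namespace SubmodularHypergraph

variable {N : ℕ} (G : SubmodularHypergraph N)

theorem convexOn_f {e : Finset (Fin N)} (he : e ∈ G.edges) : ConvexOn ℝ Set.univ (G.f e) := by
  refine convexOn_lovasz ?_ ?_ ?_
  · simpa using G.w_empty e he
  · rw [Finset.univ_inter, ← G.w_symm e he e subset_rfl, Finset.sdiff_self]
    exact G.w_empty e he
  · intro S T
    have := G.w_submodular e he (S ∩ e) Finset.inter_subset_right (T ∩ e) Finset.inter_subset_right
    rwa [← Finset.union_inter_distrib_right, ← Finset.inter_inter_distrib_right] at this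

theorem f_nonneg {e : Finset (Fin N)} (he : e ∈ G.edges) (x : Vec N) : 0 ≤ G.f e x :=
  lovasz_nonneg (fun _ => (G.w_mem e he _ Finset.inter_subset_right).1) x

theorem f_smul (e : Finset (Fin N)) {c : ℝ} (hc : 0 ≤ c) (x : Vec N) :
    G.f e (c • x) = c * G.f e x :=
  lovasz_smul _ hc x

end SubmodularHypergraph

/-! ### Sum and chain rules for subdifferentials -/

section ConvexAnalysis

variable {N : ℕ}

theorem inner_eq_sum (y v : Vec N) : inner ℝ y v = ∑ i, y i * v i := by
  simp [PiLp.inner_apply, mul_comm]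

theorem ConvexOn.continuous_vec {f : Vec N → ℝ} (hf : ConvexOn ℝ Set.univ f) : Continuous f :=
  hf.locallyLipschitz.continuous

theorem ConvexOn.finset_sum {ι : Type*} (s : Finset ι) {f : ι → Vec N → ℝ}
    (hf : ∀ i ∈ s, ConvexOn ℝ Set.univ (f i)) : ConvexOn ℝ Set.univ fun z => ∑ i ∈ s, f i z := by
  classical
  induction s using Finset.induction_on with
  | empty => simpa using convexOn_const (0 : ℝ) convex_univ
  | insert i s hi ih =>
    simp_rw [Finset.sum_insert hi]
    exact (hf i (Finset.mem_insert_self _ _)).add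
      (ih fun j hj => hf j (Finset.mem_insert_of_mem hj))

theorem ConvexOn.rpow_const {E : Type*} [AddCommMonoid E] [Module ℝ E] {s : Set E} {f : E → ℝ}
    (hf : ConvexOn ℝ s f) (h0 : ∀ z ∈ s, 0 ≤ f z) {p : ℝ} (hp : 1 ≤ p) :
    ConvexOn ℝ s fun z => f z ^ p := by
  refine ⟨hf.1, fun x hx y hy a b ha hb hab => ?_⟩
  calc f (a • x + b • y) ^ p ≤ (a • f x + b • f y) ^ p :=
        Real.rpow_le_rpow (h0 _ (hf.1 hx hy ha hb hab)) (hf.2 hx hy ha hb hab) (by linarith)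
    _ ≤ a • f x ^ p + b • f y ^ p :=
        (convexOn_rpow hp).2 (h0 x hx) (h0 y hy) ha hb hab

/-- If `x` minimizes the sum of two convex functions, then they have opposite subgradients
at `x`. -/
theorem exists_subdiff_neg_subdiff {f₁ f₂ : Vec N → ℝ} (h₁ : ConvexOn ℝ Set.univ f₁)
    (h₂ : ConvexOn ℝ Set.univ f₂) {x : Vec N} (hmin : ∀ z, f₁ x + f₂ x ≤ f₁ z + f₂ z) :
    ∃ y ∈ subdiff f₁ x, -y ∈ subdiff f₂ x := by
  -- Separate the strict epigraph of `f₁` from the hypograph of the concave function `f₁ x + f₂ x -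
  -- f₂`, which touches `f₁` at `x`.
  set A : Set (Vec N × ℝ) := {q | q.1 ∈ Set.univ ∧ f₁ q.1 < q.2} with hA
  set B : Set (Vec N × ℝ) := {q | q.1 ∈ Set.univ ∧ q.2 ≤ (f₁ x + f₂ x) - f₂ q.1} with hB
  have hAo : IsOpen A := by
    simp only [hA, Set.mem_univ, true_and]
    exact isOpen_lt (h₁.continuous_vec.comp continuous_fst) continuous_snd
  have hBc : Convex ℝ B :=
    ((concaveOn_const (f₁ x + f₂ x) convex_univ).sub h₂).convex_hypograph
  have hdisj : Disjoint A B := by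
    rw [Set.disjoint_left]
    rintro ⟨z, r⟩ ⟨_, h1⟩ ⟨_, h2⟩
    have := hmin z
    simp only at h1 h2
    linarith
  obtain ⟨φ, u, hφA, hφB⟩ := geometric_hahn_banach_open h₁.convex_strict_epigraph hAo hBc hdisj
  have hsplit : ∀ z r, φ (z, r) = φ (z, 0) + r * φ (0, 1) := by
    intro z r
    have : ((z, r) : Vec N × ℝ) = (z, 0) + r • (0, 1) := by simp
    rw [this, map_add, map_smul, smul_eq_mul]
  set β := φ (0, 1) with hβ
  have hxB : u ≤ φ (x, 0) + f₁ x * β := by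
    rw [← hsplit]; exact hφB _ ⟨trivial, by simp⟩
  -- The hyperplane is not vertical, since a point of `A` lies straight above the contact point;
  -- dividing by `-β` makes it a graph whose slope is the subgradient.
  have hβneg : β < 0 := by
    have := hφA (x, f₁ x + 1) ⟨trivial, by simp⟩
    rw [hsplit] at this
    linarith
  have hA' : ∀ z, φ (z, 0) + f₁ z * β ≤ u := by
    intro z
    refine le_of_forall_pos_le_add fun ε hε => ?_
    have := hφA (z, f₁ z + ε / (-β)) ⟨trivial, by
      have := div_pos hε (neg_pos.2 hβneg); simp only; linarith⟩
    rw [hsplit] at this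
    have h3 : ε / (-β) * β = -ε := by field_simp [hβneg.ne]
    nlinarith
  have hB' : ∀ z, u ≤ φ (z, 0) + ((f₁ x + f₂ x) - f₂ z) * β := by
    intro z
    rw [← hsplit]; exact hφB _ ⟨trivial, le_rfl⟩
  set ψ : StrongDual ℝ (Vec N) := (-β)⁻¹ • φ.comp (ContinuousLinearMap.inl ℝ (Vec N) ℝ) with hψ
  have hψz : ∀ z, ψ (z - x) = (-β)⁻¹ * (φ (z, 0) - φ (x, 0)) := by
    intro z
    simp [hψ, map_sub]
    ring
  have hpos : 0 < -β := neg_pos.2 hβneg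
  refine ⟨(InnerProductSpace.toDual ℝ (Vec N)).symm ψ, fun z => ?_, fun z => ?_⟩
  · rw [InnerProductSpace.toDual_symm_apply, hψz, inv_mul_le_iff₀ hpos]
    linarith [hA' z]
  · rw [inner_neg_left, InnerProductSpace.toDual_symm_apply, hψz, neg_le, le_inv_mul_iff₀ hpos]
    linarith [hB' z, hA' x]

/-- If `y` is a subgradient of the sum, `x` minimizes `f i` plus the remaining sum minus `inner y`;
opposite subgradients of these two parts split off one summand. -/
theorem subdiff_sum {ι : Type*} [DecidableEq ι] (s : Finset ι) {f : ι → Vec N → ℝ}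
    (hf : ∀ i ∈ s, ConvexOn ℝ Set.univ (f i)) {x y : Vec N}
    (hy : y ∈ subdiff (fun z => ∑ i ∈ s, f i z) x) :
    ∃ g : ι → Vec N, (∀ i ∈ s, g i ∈ subdiff (f i) x) ∧ y = ∑ i ∈ s, g i := by
  induction s using Finset.induction_on generalizing y with
  | empty =>
    refine ⟨0, by simp, ?_⟩
    have := hy (x + y)
    simpa using this
  | insert i s hi ih =>
    have hcs : ConvexOn ℝ Set.univ fun z => ∑ j ∈ s, f j z :=
      ConvexOn.finset_sum s fun j hj => hf j (Finset.mem_insert_of_mem hj)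
    have hlin : ConvexOn ℝ Set.univ fun z : Vec N => inner ℝ (-y) z :=
      (innerₛₗ ℝ (-y)).convexOn convex_univ
    obtain ⟨y₁, hy₁, hy₂⟩ := exists_subdiff_neg_subdiff (x := x)
      (hf i (Finset.mem_insert_self _ _)) (hcs.add hlin) (by
        intro z
        have := hy z
        simp only [Finset.sum_insert hi, inner_sub_right] at this
        simp only [Pi.add_apply, inner_neg_left]
        linarith)
    obtain ⟨g, hg, hgs⟩ := ih (y := y - y₁) (fun j hj => hf j (Finset.mem_insert_of_mem hj)) (by
      intro z
      have := hy₂ z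
      simp only [Pi.add_apply, inner_neg_left, inner_sub_right] at this
      simp only [inner_sub_left, inner_sub_right]
      linarith)
    refine ⟨fun j => if j = i then y₁ else g j, ?_, ?_⟩
    · intro j hj
      by_cases hji : j = i
      · subst hji; simpa using hy₁
      · simpa [hji] using hg j (Finset.mem_of_mem_insert_of_ne hj hji)
    · rw [Finset.sum_insert hi]
      have : ∑ j ∈ s, (if j = i then y₁ else g j) = ∑ j ∈ s, g j :=
        Finset.sum_congr rfl fun j hj => if_neg fun (h : j = i) => hi (h ▸ hj)
      rw [this, ← hgs]
      simp

/-- The tangent line lies below the power: Bernoulli's inequality at `b / a - 1`, rescaled by `a ^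
p`. -/
theorem rpow_add_mul_sub_le_rpow {a b p : ℝ} (ha : 0 ≤ a) (hb : 0 ≤ b) (hp : 1 ≤ p) :
    a ^ p + p * a ^ (p - 1) * (b - a) ≤ b ^ p := by
  rcases ha.eq_or_lt with rfl | ha
  · rcases hp.eq_or_lt with rfl | hp
    · simp
    · rw [Real.zero_rpow (by linarith), Real.zero_rpow (by linarith)]
      simpa using Real.rpow_nonneg hb p
  · have h1 := one_add_mul_self_le_rpow_one_add (s := b / a - 1)
      (by have := div_nonneg hb ha.le; linarith) hp
    have h2 : (1 + (b / a - 1)) ^ p * a ^ p = b ^ p := by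
      rw [← Real.mul_rpow (by have := div_nonneg hb ha.le; linarith) ha.le]
      congr 1
      field_simp
      ring
    have h3 : a ^ p = a ^ (p - 1) * a := by
      rw [Real.rpow_sub_one ha.ne']; field_simp
    have h4 := mul_le_mul_of_nonneg_right h1 (Real.rpow_nonneg ha.le p)
    rw [h2] at h4
    refine le_trans (le_of_eq ?_) h4
    rw [h3]
    field_simp

theorem smul_mem_subdiff_rpow {f : Vec N → ℝ} (h0 : ∀ z, 0 ≤ f z) {p c : ℝ} (hp : 1 ≤ p)
    (hc : 0 ≤ c) {x g : Vec N} (hg : g ∈ subdiff f x) :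
    (c * p * f x ^ (p - 1)) • g ∈ subdiff (fun z => c * f z ^ p) x := by
  intro z
  have h1 := mul_le_mul_of_nonneg_left (hg z)
    (mul_nonneg (mul_nonneg hc (by linarith : (0 : ℝ) ≤ p)) (Real.rpow_nonneg (h0 x) (p - 1)))
  have h2 := mul_le_mul_of_nonneg_left (rpow_add_mul_sub_le_rpow (h0 x) (h0 z) hp) hc
  rw [real_inner_smul_left]
  linarith

/-- Chain rule for the subdifferential of a power of a nonnegative convex function. -/
theorem exists_of_mem_subdiff_rpow {f : Vec N → ℝ} (hf : ConvexOn ℝ Set.univ f)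
    (h0 : ∀ z, 0 ≤ f z) {p c : ℝ} (hp : 1 ≤ p) (hc : 0 < c) {x y : Vec N}
    (hy : y ∈ subdiff (fun z => c * f z ^ p) x) :
    ∃ g ∈ subdiff f x, y = (c * p * f x ^ (p - 1)) • g := by
  -- Convexity bounds `f (x + t • v)` by its chord, and the power of the chord is differentiable at
  -- `t = 0`.
  have key : ∀ v, inner ℝ y v ≤ (c * p * f x ^ (p - 1)) * (f (x + v) - f x) := by
    intro v
    set δ := f (x + v) - f x with hδ
    have hd : HasDerivAt (fun t : ℝ => c * (f x + t * δ) ^ p) (c * p * f x ^ (p - 1) * δ) 0 := by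
      have h1 : HasDerivAt (fun t : ℝ => f x + t * δ) δ 0 := by
        simpa using ((hasDerivAt_id (0 : ℝ)).mul_const δ).const_add (f x)
      have h2 := (h1.rpow_const (p := p) (Or.inr hp)).const_mul c
      rw [zero_mul, add_zero] at h2
      exact h2.congr_deriv (by ring)
    refine ge_of_tendsto hd.tendsto_slope_zero_right ?_
    filter_upwards [Ioo_mem_nhdsGT (zero_lt_one' ℝ)] with t ht
    have h1 := hy (x + t • v)
    have h2 : f (x + t • v) ≤ f x + t * δ := by
      have := hf.2 (Set.mem_univ x) (Set.mem_univ (x + v)) (sub_nonneg.2 ht.2.le) ht.1.le (by ring)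
      have hx : (1 - t) • x + t • (x + v) = x + t • v := by module
      rw [hx] at this
      simp only [smul_eq_mul] at this
      linarith
    have h3 : f (x + t • v) ^ p ≤ (f x + t * δ) ^ p :=
      Real.rpow_le_rpow (h0 _) h2 (by linarith)
    have h4 := mul_le_mul_of_nonneg_left h3 hc.le
    simp only [add_sub_cancel_left, real_inner_smul_right] at h1
    rw [smul_eq_mul, le_inv_mul_iff₀ ht.1]
    simp only [zero_add, zero_mul, add_zero]
    linarith
  -- The coefficient vanishes only if `p > 1` and `f x = 0`; then `x` minimizes `f`, so `0` is a
  -- subgradient, and `key` at `v = y` gives `y = 0`.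
  by_cases hk : c * p * f x ^ (p - 1) = 0
  · have hfx : f x = 0 := by
      have : f x ^ (p - 1) = 0 := by
        have : c * p ≠ 0 := by positivity
        simpa [this] using hk
      exact ((Real.rpow_eq_zero_iff_of_nonneg (h0 x)).1 this).1
    refine ⟨0, fun z => by simpa [hfx] using h0 z, ?_⟩
    have := key y
    rw [hk, zero_mul] at this
    simpa using this
  · have hpos : 0 < c * p * f x ^ (p - 1) :=
      lt_of_le_of_ne (by have := Real.rpow_nonneg (h0 x) (p - 1); positivity) (Ne.symm hk)
    refine ⟨(c * p * f x ^ (p - 1))⁻¹ • y, fun z => ?_, by rw [smul_inv_smul₀ hk]⟩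
    have := key (z - x)
    rw [add_sub_cancel] at this
    rwa [real_inner_smul_left, inv_mul_le_iff₀ hpos]

end ConvexAnalysis

/-! ### The subdifferential of `Q p` and Euler's identity -/

namespace SubmodularHypergraph

variable {N : ℕ} (G : SubmodularHypergraph N)

theorem convexOn_Q {p : ℝ} (hp : 1 ≤ p) : ConvexOn ℝ Set.univ (G.Q p) :=
  ConvexOn.finset_sum _ fun e he =>
    ((G.convexOn_f he).rpow_const (fun z _ => G.f_nonneg he z) hp).smul (G.ϑ_pos e he).le

theorem Q_nonneg (p : ℝ) (x : Vec N) : 0 ≤ G.Q p x :=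
  Finset.sum_nonneg fun e he =>
    mul_nonneg (G.ϑ_pos e he).le (Real.rpow_nonneg (G.f_nonneg he x) p)

theorem mem_subdiff_Q_iff {p : ℝ} (hp : 1 ≤ p) {x y : Vec N} :
    y ∈ subdiff (G.Q p) x ↔ ∃ z ∈ G.laplacian p x, y = p • z := by
  constructor
  · intro hy
    obtain ⟨g, hg, hgs⟩ := subdiff_sum G.edges (f := fun e z => G.ϑ e * G.f e z ^ p)
      (fun e he => ((G.convexOn_f he).rpow_const
        (fun z _ => G.f_nonneg he z) hp).smul (G.ϑ_pos e he).le) hy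
    have : ∀ e, ∃ k, e ∈ G.edges →
        k ∈ subdiff (G.f e) x ∧ g e = (G.ϑ e * p * G.f e x ^ (p - 1)) • k := by
      intro e
      by_cases he : e ∈ G.edges
      · obtain ⟨k, hk⟩ := exists_of_mem_subdiff_rpow (G.convexOn_f he) (G.f_nonneg he) hp
          (G.ϑ_pos e he) (hg e he)
        exact ⟨k, fun _ => hk⟩
      · exact ⟨0, fun h => absurd h he⟩
    choose k hk using this
    refine ⟨_, ⟨k, fun e he => (hk e he).1, rfl⟩, ?_⟩
    rw [hgs, Finset.smul_sum]
    refine Finset.sum_congr rfl fun e he => ?_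
    rw [(hk e he).2, smul_smul]
    congr 1
    ring
  · rintro ⟨_, ⟨k, hk, rfl⟩, rfl⟩ z
    rw [Finset.smul_sum, sum_inner, Q, Q, ← Finset.sum_sub_distrib]
    refine Finset.sum_le_sum fun e he => ?_
    have := smul_mem_subdiff_rpow (G.f_nonneg he) hp (G.ϑ_pos e he).le (hk e he) z
    rwa [smul_smul, show p * (G.ϑ e * G.f e x ^ (p - 1)) = G.ϑ e * p * G.f e x ^ (p - 1) by ring]

/-- Euler's identity: by homogeneity, the subgradient inequality at `2x` and at `0` gives the two
bounds. -/
theorem inner_of_mem_subdiff_f {e : Finset (Fin N)} {x g : Vec N}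
    (hg : g ∈ subdiff (G.f e) x) : inner ℝ g x = G.f e x := by
  have h1 := hg ((2 : ℝ) • x)
  have h2 := hg ((0 : ℝ) • x)
  rw [G.f_smul e (by norm_num), two_smul, add_sub_cancel_right] at h1
  rw [G.f_smul e le_rfl, zero_smul, zero_sub, inner_neg_right] at h2
  linarith

theorem inner_of_mem_laplacian {p : ℝ} (hp : 1 ≤ p) {x y : Vec N} (hy : y ∈ G.laplacian p x) :
    inner ℝ y x = G.Q p x := by
  obtain ⟨g, hg, rfl⟩ := hy
  rw [sum_inner, Q]
  refine Finset.sum_congr rfl fun e he => ?_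
  rw [real_inner_smul_left, G.inner_of_mem_subdiff_f (hg e he), mul_assoc]
  congr 1
  have h0 := G.f_nonneg he x
  rw [← Real.rpow_add_one' h0 (by linarith), sub_add_cancel]

end SubmodularHypergraph

/-! ### One-sided derivatives of powers, projections onto cones -/

section DirectionalDerivative

variable {N : ℕ}

/-- The one-sided derivative of `|·|` at `a` in the direction `b`. -/
def absDir (a b : ℝ) : ℝ :=
  if 0 < a then b else if a < 0 then -b else |b|

/-- The one-sided derivative of `|·|^p / p` at `a` in the direction `b`. -/
def powDir (p a b : ℝ) : ℝ := |a| ^ (p - 1) * absDir a b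

theorem mul_le_absDir {a s : ℝ} (hs : s ∈ sgnSet a) (b : ℝ) : s * b ≤ absDir a b := by
  unfold sgnSet at hs
  unfold absDir
  split_ifs at hs ⊢
  · simp only [Set.mem_singleton_iff] at hs; simp [hs]
  · simp only [Set.mem_singleton_iff] at hs; simp [hs]
  · have h1 : |s| ≤ 1 := abs_le.2 hs
    calc s * b ≤ |s * b| := le_abs_self _
      _ = |s| * |b| := abs_mul _ _
      _ ≤ 1 * |b| := mul_le_mul_of_nonneg_right h1 (abs_nonneg b)
      _ = |b| := one_mul _

theorem mul_self_of_mem_sgnSet {a s : ℝ} (hs : s ∈ sgnSet a) : s * a = |a| := by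
  unfold sgnSet at hs
  split_ifs at hs with h1 h2
  · simp only [Set.mem_singleton_iff] at hs; simp [hs, abs_of_pos h1]
  · simp only [Set.mem_singleton_iff] at hs; simp [hs, abs_of_neg h2]
  · simp [le_antisymm (not_lt.1 h1) (not_lt.1 h2)]

theorem exists_mem_sgnSet {a k y : ℝ} (hk : 0 ≤ k) (h : ∀ b, y * b ≤ k * absDir a b) :
    ∃ s ∈ sgnSet a, y = k * s := by
  unfold absDir at h
  unfold sgnSet
  have h1 := h 1
  have h2 := h (-1)
  split_ifs at h1 h2 ⊢
  · exact ⟨1, rfl, by linarith⟩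
  · exact ⟨-1, rfl, by linarith⟩
  · simp only [abs_one, abs_neg, mul_one] at h1 h2
    rcases hk.eq_or_lt with rfl | hk
    · exact ⟨0, by simp, by linarith⟩
    · refine ⟨y / k, ⟨?_, ?_⟩, by field_simp⟩
      · rw [le_div_iff₀ hk]; linarith
      · rw [div_le_iff₀ hk]; linarith

theorem absDir_add_mul (a b c : ℝ) : absDir a (b + c * a) = absDir a b + c * |a| := by
  unfold absDir
  split_ifs with h1 h2
  · rw [abs_of_pos h1]
  · rw [abs_of_neg h2]; ring
  · simp [le_antisymm (not_lt.1 h1) (not_lt.1 h2)]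

theorem absDir_mul {c : ℝ} (hc : 0 ≤ c) (a b : ℝ) : absDir a (c * b) = c * absDir a b := by
  unfold absDir
  split_ifs
  · rfl
  · ring
  · rw [abs_mul, abs_of_nonneg hc]

/-- At `a = 0` the factor `|a| ^ (p - 1)` kills the kink of `absDir`. For `p = 1` that factor is
`1`, and this is where the two cases of the theorem part. -/
theorem powDir_neg {p : ℝ} (hp : 1 < p) (a b : ℝ) : powDir p a (-b) = -powDir p a b := by
  unfold powDir absDir
  split_ifs with h1 h2
  · ring
  · ring
  · simp [le_antisymm (not_lt.1 h1) (not_lt.1 h2), Real.zero_rpow (sub_pos.2 hp).ne']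

theorem abs_rpow_sub_one_mul_abs {p : ℝ} (hp : 1 ≤ p) (a : ℝ) :
    |a| ^ (p - 1) * |a| = |a| ^ p := by
  rw [← Real.rpow_add_one' (abs_nonneg a) (by linarith), sub_add_cancel]

/-- The form with `c n * d n → b` matches the definition of tangent cones. Only `p = 1`, `a = 0`
lacks a derivative; there `c * |d| = |c * d|` gives the limit. -/
theorem tendsto_mul_abs_rpow_sub {α : Type*} {l : Filter α} {p : ℝ} (hp : 1 ≤ p) {a b : ℝ}
    {c d : α → ℝ} (hc : ∀ n, 0 ≤ c n) (hd : Tendsto d l (𝓝 0))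
    (hcd : Tendsto (fun n => c n * d n) l (𝓝 b)) :
    Tendsto (fun n => c n * (|a + d n| ^ p - |a| ^ p)) l (𝓝 (p * powDir p a b)) := by
  have diff : ∀ {f : ℝ → ℝ} {f' : ℝ}, HasDerivAt f f' a →
      Tendsto (fun n => c n * (f (a + d n) - f a)) l (𝓝 (b * f')) := by
    intro f f' hf
    have := (hf.hasFDerivAt.hasFDerivWithinAt (s := Set.univ)).lim hd (by simp) hcd
    simpa using this
  rcases hp.eq_or_lt with rfl | hp
  · simp only [Real.rpow_one, powDir, sub_self, Real.rpow_zero, one_mul]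
    unfold absDir
    split_ifs with h1 h2
    · simpa using diff (hasDerivAt_abs_pos h1)
    · simpa using diff (hasDerivAt_abs_neg h2)
    · have ha : a = 0 := le_antisymm (not_lt.1 h1) (not_lt.1 h2)
      subst ha
      refine hcd.abs.congr fun n => ?_
      simp [abs_mul, abs_of_nonneg (hc n)]
  · convert diff (hasDerivAt_abs_rpow a hp) using 2
    unfold powDir absDir
    split_ifs with h1 h2
    · rw [abs_of_pos h1, show p - 1 = (p - 2) + 1 by ring, Real.rpow_add_one h1.ne']
      ring
    · rw [show p - 1 = (p - 2) + 1 by ring, Real.rpow_add_one (abs_pos.2 h2.ne).ne']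
      rw [abs_of_neg h2]
      ring
    · simp [le_antisymm (not_lt.1 h1) (not_lt.1 h2), Real.zero_rpow (sub_pos.2 hp).ne']

/-- The metric projection onto a cone vanishes exactly on the polar cone. -/
theorem metricProj_eq_zero_iff {T : Set (Vec N)} (h0 : (0 : Vec N) ∈ T)
    (hT : ∀ t : ℝ, 0 < t → ∀ d ∈ T, t • d ∈ T) (y : Vec N) :
    metricProj T y = {0} ↔ ∀ d ∈ T, inner ℝ y d ≤ 0 := by
  have hdist : ∀ d, dist y d ^ 2 = ‖y‖ ^ 2 - 2 * inner ℝ y d + ‖d‖ ^ 2 := by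
    intro d; rw [dist_eq_norm, norm_sub_sq_real]
  have hdist0 : dist y 0 ^ 2 = ‖y‖ ^ 2 := by rw [dist_zero_right]
  constructor
  · intro h d hd
    by_contra! hpos
    have hd0 : d ≠ 0 := by rintro rfl; simp at hpos
    have hn : 0 < ‖d‖ ^ 2 := by have := norm_pos_iff.2 hd0; positivity
    have hmem : (0 : Vec N) ∈ metricProj T y := by rw [h]; rfl
    -- The point of the ray through `d` nearest to `y`, strictly nearer than `0`.
    set t := inner ℝ y d / ‖d‖ ^ 2 with ht
    have htpos : 0 < t := div_pos hpos hn
    have h1 := hmem.2 (t • d) (hT t htpos d hd)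
    have h2 := pow_le_pow_left₀ dist_nonneg h1 2
    rw [hdist0, hdist, real_inner_smul_right, norm_smul, mul_pow, Real.norm_eq_abs, sq_abs] at h2
    have h3 : t * ‖d‖ ^ 2 = inner ℝ y d := by rw [ht]; field_simp
    nlinarith
  · intro h
    ext z
    rw [Set.mem_singleton_iff]
    constructor
    · rintro ⟨hz, hmin⟩
      have h2 := pow_le_pow_left₀ dist_nonneg (hmin 0 h0) 2
      rw [hdist0, hdist] at h2
      have h3 := h z hz
      have : ‖z‖ ^ 2 ≤ 0 := by linarith
      exact norm_eq_zero.1 (pow_eq_zero_iff two_ne_zero |>.1 (le_antisymm this (sq_nonneg _)))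
    · rintro rfl
      refine ⟨h0, fun d hd => ?_⟩
      rw [← pow_le_pow_iff_left₀ dist_nonneg dist_nonneg two_ne_zero, hdist0, hdist]
      have := h d hd
      nlinarith [sq_nonneg ‖d‖]

end DirectionalDerivative

/-! ### The weighted norm and the tangent cone of its sphere -/

namespace SubmodularHypergraph

variable {N : ℕ} (G : SubmodularHypergraph N)

/-- The `p`-th power of the weighted norm. -/
def mass (p : ℝ) (x : Vec N) : ℝ := ∑ v, G.μ v * |x v| ^ p

/-- The one-sided derivative of `mass p / p` at `x` in the direction `d`. -/
def massDir (p : ℝ) (x d : Vec N) : ℝ := ∑ v, G.μ v * powDir p (x v) (d v)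

theorem mass_nonneg (p : ℝ) (x : Vec N) : 0 ≤ G.mass p x :=
  Finset.sum_nonneg fun v _ => mul_nonneg (G.μ_pos v).le (Real.rpow_nonneg (abs_nonneg _) p)

theorem lpNorm_rpow {p : ℝ} (hp : 1 ≤ p) (x : Vec N) : G.lpNorm p x ^ p = G.mass p x := by
  have : p ≠ 0 := by linarith
  change (G.mass p x ^ (1 / p)) ^ p = _
  rw [← Real.rpow_mul (G.mass_nonneg p x), one_div, inv_mul_cancel₀ this, Real.rpow_one]

theorem R_eq {p : ℝ} (hp : 1 ≤ p) (x : Vec N) : G.R p x = G.Q p x / G.mass p x := by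
  rw [R, G.lpNorm_rpow hp]

theorem mem_sphere_iff {p : ℝ} (hp : 1 ≤ p) (x : Vec N) : x ∈ G.sphere p ↔ G.mass p x = 1 := by
  have h0 : 0 ≤ G.lpNorm p x := Real.rpow_nonneg (G.mass_nonneg p x) _
  have : p ≠ 0 := by linarith
  rw [← G.lpNorm_rpow hp]
  change G.lpNorm p x = 1 ↔ _
  rw [← Real.rpow_left_inj h0 zero_le_one this, Real.one_rpow]

theorem convexOn_mass {p : ℝ} (hp : 1 ≤ p) : ConvexOn ℝ Set.univ (G.mass p) := by
  refine ConvexOn.finset_sum _ fun v _ => ConvexOn.smul (G.μ_pos v).le ?_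
  refine ConvexOn.rpow_const ⟨convex_univ, fun x _ y _ a b ha hb _ => ?_⟩
    (fun z _ => abs_nonneg _) hp
  simp only [PiLp.add_apply, PiLp.smul_apply, smul_eq_mul]
  refine (abs_add_le _ _).trans ?_
  rw [abs_mul, abs_mul, abs_of_nonneg ha, abs_of_nonneg hb]

theorem mass_smul (p c : ℝ) (x : Vec N) : G.mass p (c • x) = |c| ^ p * G.mass p x := by
  unfold mass
  rw [Finset.mul_sum]
  refine Finset.sum_congr rfl fun v _ => ?_
  rw [PiLp.smul_apply, smul_eq_mul, abs_mul, Real.mul_rpow (abs_nonneg _) (abs_nonneg _)]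
  ring

theorem massDir_add_smul {p : ℝ} (hp : 1 ≤ p) (x d : Vec N) (c : ℝ) :
    G.massDir p x (d + c • x) = G.massDir p x d + c * G.mass p x := by
  unfold massDir mass powDir
  rw [Finset.mul_sum, ← Finset.sum_add_distrib]
  refine Finset.sum_congr rfl fun v _ => ?_
  rw [PiLp.add_apply, PiLp.smul_apply, smul_eq_mul, absDir_add_mul, ← abs_rpow_sub_one_mul_abs hp]
  ring

theorem massDir_smul {p c : ℝ} (hc : 0 ≤ c) (x d : Vec N) :
    G.massDir p x (c • d) = c * G.massDir p x d := by
  unfold massDir powDir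
  rw [Finset.mul_sum]
  refine Finset.sum_congr rfl fun v _ => ?_
  rw [PiLp.smul_apply, smul_eq_mul, absDir_mul hc]
  ring

theorem massDir_neg {p : ℝ} (hp : 1 < p) (x d : Vec N) :
    G.massDir p x (-d) = -G.massDir p x d := by
  unfold massDir
  rw [← Finset.sum_neg_distrib]
  refine Finset.sum_congr rfl fun v _ => ?_
  rw [PiLp.neg_apply, powDir_neg hp, mul_neg]

theorem tendsto_mul_mass_sub {α : Type*} {l : Filter α} {p : ℝ} (hp : 1 ≤ p) {x w : Vec N}
    {c : α → ℝ} {d : α → Vec N} (hc : ∀ n, 0 ≤ c n) (hd : Tendsto d l (𝓝 0))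
    (hcd : Tendsto (fun n => c n • d n) l (𝓝 w)) :
    Tendsto (fun n => c n * (G.mass p (x + d n) - G.mass p x)) l (𝓝 (p * G.massDir p x w)) := by
  have hcoord : ∀ {f : α → Vec N} {z : Vec N} (v : Fin N), Tendsto f l (𝓝 z) →
      Tendsto (fun n => f n v) l (𝓝 (z v)) := fun v h =>
    ((EuclideanSpace.proj (𝕜 := ℝ) v).continuous.tendsto _).comp h
  have : ∀ v, Tendsto (fun n => G.μ v * (c n * (|x v + d n v| ^ p - |x v| ^ p))) l
      (𝓝 (G.μ v * (p * powDir p (x v) (w v)))) := fun v =>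
    (tendsto_mul_abs_rpow_sub hp hc (hcoord v hd) (hcoord v hcd)).const_mul _
  have hs := tendsto_finsetSum Finset.univ fun v _ => this v
  have he : ∑ v, G.μ v * (p * powDir p (x v) (w v)) = p * G.massDir p x w := by
    rw [massDir, Finset.mul_sum]
    exact Finset.sum_congr rfl fun v _ => by ring
  rw [he] at hs
  refine hs.congr fun n => ?_
  rw [mass, mass, ← Finset.sum_sub_distrib, Finset.mul_sum]
  refine Finset.sum_congr rfl fun v _ => ?_
  rw [PiLp.add_apply]
  ring

theorem tendsto_smul_zero (w : Vec N) : Tendsto (fun t : ℝ => t • w) (𝓝[>] 0) (𝓝 0) := by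
  have : Tendsto (fun t : ℝ => t • w) (𝓝 0) (𝓝 ((0 : ℝ) • w)) :=
    (continuous_id.smul continuous_const).tendsto _
  rw [zero_smul] at this
  exact this.mono_left nhdsWithin_le_nhds

theorem tendsto_mass_quotient {p : ℝ} (hp : 1 ≤ p) (x w : Vec N) :
    Tendsto (fun t : ℝ => t⁻¹ * (G.mass p (x + t • w) - G.mass p x)) (𝓝[>] 0)
      (𝓝 (p * G.massDir p x w)) := by
  have h1 : Tendsto (fun t : ℝ => |t|⁻¹ • t • w) (𝓝[>] 0) (𝓝 w) := by
    refine tendsto_const_nhds.congr' ?_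
    filter_upwards [self_mem_nhdsWithin] with t (ht : 0 < t)
    rw [abs_of_pos ht, inv_smul_smul₀ ht.ne']
  refine (G.tendsto_mul_mass_sub hp (fun t => inv_nonneg.2 (abs_nonneg t))
    (tendsto_smul_zero w) h1).congr' ?_
  filter_upwards [self_mem_nhdsWithin] with t (ht : 0 < t)
  rw [abs_of_pos ht]

/-- `mass` is constant on the sphere, so tangent directions have zero derivative. Conversely,
rescaling `x + t • w` back to the sphere costs a factor `1 + o(t)` when the derivative is zero, so
the rescaled curve still leaves `x` in direction `w`, even at corners for `p = 1`. -/
theorem mem_posTangentConeAt_sphere_iff {p : ℝ} (hp : 1 ≤ p) {x : Vec N} (hx : x ∈ G.sphere p)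
    (w : Vec N) : w ∈ posTangentConeAt (G.sphere p) x ↔ G.massDir p x w = 0 := by
  have hp0 : p ≠ 0 := by linarith
  have hx1 := (G.mem_sphere_iff hp x).1 hx
  constructor
  · intro hw
    obtain ⟨α, l, _, c, d, hd, hmem, hcd⟩ := exists_fun_of_mem_tangentConeAt hw
    have h1 := G.tendsto_mul_mass_sub hp (x := x) (c := fun n => (c n : ℝ)) (d := d)
      (fun n => (c n).2) hd hcd
    have h2 : Tendsto (fun n => (c n : ℝ) * (G.mass p (x + d n) - G.mass p x)) l (𝓝 0) := by
      refine tendsto_const_nhds.congr' ?_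
      filter_upwards [hmem] with n hn
      rw [(G.mem_sphere_iff hp _).1 hn, hx1, sub_self, mul_zero]
    simpa [hp0] using tendsto_nhds_unique h1 h2
  · intro hw
    set m : ℝ → ℝ := fun t => G.mass p (x + t • w) with hm
    have hq := G.tendsto_mass_quotient hp x w
    rw [hw, mul_zero, hx1] at hq
    have hmt : Tendsto m (𝓝[>] 0) (𝓝 1) := by
      have h1 : Tendsto (fun t : ℝ => x + t • w) (𝓝[>] 0) (𝓝 x) := by
        simpa using (tendsto_smul_zero w).const_add x
      have h2 := ((G.convexOn_mass hp).continuous_vec.tendsto x).comp h1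
      rw [hx1] at h2
      exact h2
    have hmt' : Tendsto (fun t => m t - 1) (𝓝[>] 0) (𝓝 0) := by
      simpa using hmt.sub_const 1
    set r : ℝ → ℝ := fun t => m t ^ (-(1 / p)) with hr
    have hder : HasDerivAt (fun u : ℝ => u ^ (-(1 / p))) (-(1 / p) * 1 ^ (-(1 / p) - 1)) 1 :=
      Real.hasDerivAt_rpow_const (Or.inl one_ne_zero)
    have hrq : Tendsto (fun t => t⁻¹ * (r t - 1)) (𝓝[>] 0) (𝓝 0) := by
      have := (hder.hasFDerivAt.hasFDerivWithinAt (s := Set.univ)).lim hmt' (by simp) hq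
      simpa [hr] using this
    have hrt : Tendsto r (𝓝[>] 0) (𝓝 1) := by
      have := hder.continuousAt.tendsto.comp hmt
      rw [Real.one_rpow] at this
      exact this
    refine mem_tangentConeAt_of_seq (𝓝[>] (0 : ℝ)) (fun t => (t⁻¹).toNNReal)
      (fun t => r t • (x + t • w) - x) ?_ ?_ ?_
    · have h1 : Tendsto (fun t : ℝ => x + t • w) (𝓝[>] 0) (𝓝 x) := by
        simpa using (tendsto_smul_zero w).const_add x
      simpa using (hrt.smul h1).sub_const x
    · filter_upwards [hmt.eventually (lt_mem_nhds zero_lt_one)] with t ht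
      rw [add_sub_cancel, G.mem_sphere_iff hp, G.mass_smul,
        abs_of_nonneg (Real.rpow_nonneg ht.le _)]
      change (m t ^ (-(1 / p))) ^ p * m t = 1
      rw [← Real.rpow_mul ht.le, show -(1 / p) * p = -1 by field_simp, Real.rpow_neg_one,
        inv_mul_cancel₀ ht.ne']
    · have h1 : Tendsto (fun t => (t⁻¹ * (r t - 1)) • x + r t • w) (𝓝[>] 0) (𝓝 w) := by
        simpa using (hrq.smul_const x).add (hrt.smul_const w)
      refine h1.congr' ?_
      filter_upwards [self_mem_nhdsWithin] with t (ht : 0 < t)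
      rw [NNReal.smul_def, Real.coe_toNNReal _ (inv_nonneg.2 ht.le)]
      have : r t • (x + t • w) - x = (r t - 1) • x + (t * r t) • w := by module
      rw [this, smul_add, smul_smul, smul_smul, inv_mul_cancel_left₀ ht.ne']

theorem metricProj_tangentCone_sphere_iff {p : ℝ} (hp : 1 ≤ p) {x : Vec N}
    (hx : x ∈ G.sphere p) (y : Vec N) :
    metricProj (posTangentConeAt (G.sphere p) x) y = {0} ↔
      ∀ d, G.massDir p x d = 0 → inner ℝ y d ≤ 0 := by
  rw [metricProj_eq_zero_iff]
  · simp_rw [G.mem_posTangentConeAt_sphere_iff hp hx]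
  · rw [G.mem_posTangentConeAt_sphere_iff hp hx]
    simpa using G.massDir_smul (p := p) le_rfl x 0
  · intro t ht d hd
    rw [G.mem_posTangentConeAt_sphere_iff hp hx] at hd ⊢
    rw [G.massDir_smul ht.le, hd, mul_zero]

/-! ### Eigenpairs as an inequality with `massDir` -/

theorem inner_le_massDir {p k : ℝ} (hk : 0 ≤ k) {x y : Vec N} (hy : y ∈ G.scaledPhi k p x)
    (d : Vec N) : inner ℝ y d ≤ k * G.massDir p x d := by
  obtain ⟨z, hz, hyz⟩ := hy
  rw [inner_eq_sum, massDir, Finset.mul_sum]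
  refine Finset.sum_le_sum fun v _ => ?_
  obtain ⟨s, hs, hzs⟩ := hz v
  rw [hyz, hzs, powDir]
  have h1 := mul_le_absDir hs (d v)
  have h2 := mul_le_mul_of_nonneg_left h1
    (mul_nonneg hk (mul_nonneg (G.μ_pos v).le (Real.rpow_nonneg (abs_nonneg (x v)) (p - 1))))
  linarith

theorem inner_of_mem_scaledPhi {p k : ℝ} (hp : 1 ≤ p) {x y : Vec N}
    (hy : y ∈ G.scaledPhi k p x) : inner ℝ y x = k * G.mass p x := by
  obtain ⟨z, hz, hyz⟩ := hy
  rw [inner_eq_sum, mass, Finset.mul_sum]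
  refine Finset.sum_congr rfl fun v _ => ?_
  obtain ⟨s, hs, hzs⟩ := hz v
  rw [hyz, hzs, ← abs_rpow_sub_one_mul_abs hp, ← mul_self_of_mem_sgnSet hs]
  ring

/-- `massDir` is a sum over coordinates, so testing on multiples of basis vectors recovers each
coordinate condition. -/
theorem mem_scaledPhi_of_inner_le {p k : ℝ} (hk : 0 ≤ k) {x y : Vec N}
    (h : ∀ d, inner ℝ y d ≤ k * G.massDir p x d) : y ∈ G.scaledPhi k p x := by
  have key : ∀ v, ∃ s ∈ sgnSet (x v), y v = (k * (G.μ v * |x v| ^ (p - 1))) * s := by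
    intro v
    refine exists_mem_sgnSet (mul_nonneg hk (mul_nonneg (G.μ_pos v).le
      (Real.rpow_nonneg (abs_nonneg _) _))) fun b => ?_
    have h1 := h (EuclideanSpace.single v b)
    have h2 : G.massDir p x (EuclideanSpace.single v b) =
        G.μ v * (|x v| ^ (p - 1) * absDir (x v) b) := by
      unfold massDir powDir
      rw [Finset.sum_eq_single v]
      · simp
      · intro u _ huv
        have : absDir (x u) 0 = 0 := by simp [absDir]
        simp [huv, this]
      · simp
    rw [h2, inner_eq_sum, Finset.sum_eq_single v (by intro u _ huv; simp [huv]) (by simp)] at h1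
    simp only [PiLp.single_apply, if_true] at h1
    linarith
  choose s hs hys using key
  refine ⟨WithLp.toLp 2 fun v => |x v| ^ (p - 1) * s v, fun v => ⟨s v, hs v, rfl⟩, fun v => ?_⟩
  rw [hys]
  ring

theorem ne_zero_of_mass_eq_one {p : ℝ} (hp : 1 ≤ p) {x : Vec N} (hx : G.mass p x = 1) :
    x ≠ 0 := by
  rintro rfl
  have : (0 : ℝ) ^ p = 0 := Real.zero_rpow (by linarith)
  simp [mass, this] at hx

theorem isEigenpair_iff {p lam : ℝ} (hp : 1 ≤ p) {x : Vec N} (hx : x ∈ G.sphere p) :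
    G.IsEigenpair p lam x ↔ G.Q p x = lam ∧
      ∃ y ∈ subdiff (G.Q p) x, ∀ d, inner ℝ y d ≤ p * lam * G.massDir p x d := by
  have hp0 : 0 < p := by linarith
  have hx1 := (G.mem_sphere_iff hp x).1 hx
  constructor
  · rintro ⟨_, z, hz, hzphi⟩
    have hQ : G.Q p x = lam := by
      rw [← G.inner_of_mem_laplacian hp hz, G.inner_of_mem_scaledPhi hp hzphi, hx1, mul_one]
    have hl : 0 ≤ lam := hQ ▸ G.Q_nonneg p x
    refine ⟨hQ, p • z, (G.mem_subdiff_Q_iff hp).2 ⟨z, hz, rfl⟩, fun d => ?_⟩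
    rw [real_inner_smul_left, mul_assoc]
    exact mul_le_mul_of_nonneg_left (G.inner_le_massDir hl hzphi d) hp0.le
  · rintro ⟨hQ, y, hy, hyd⟩
    have hl : 0 ≤ lam := hQ ▸ G.Q_nonneg p x
    obtain ⟨z, hz, rfl⟩ := (G.mem_subdiff_Q_iff hp).1 hy
    refine ⟨G.ne_zero_of_mass_eq_one hp hx1, z, hz, G.mem_scaledPhi_of_inner_le hl fun d => ?_⟩
    have := hyd d
    rw [real_inner_smul_left, mul_assoc] at this
    exact le_of_mul_le_mul_left this hp0

theorem isEigenpair_iff_isCriticalQ {p lam : ℝ} (hp : 1 ≤ p) {x : Vec N}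
    (hx : x ∈ G.sphere p) : G.IsEigenpair p lam x ↔ G.IsCriticalQ p x ∧ G.Q p x = lam := by
  have hx1 := (G.mem_sphere_iff hp x).1 hx
  rw [G.isEigenpair_iff hp hx]
  constructor
  · rintro ⟨hQ, y, hy, hyd⟩
    refine ⟨⟨hx, y, hy, (G.metricProj_tangentCone_sphere_iff hp hx y).2 fun d hd => ?_⟩, hQ⟩
    simpa [hd] using hyd d
  · rintro ⟨⟨_, y, hy, hproj⟩, hQ⟩
    rw [G.metricProj_tangentCone_sphere_iff hp hx] at hproj
    refine ⟨hQ, y, hy, fun d => ?_⟩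
    have hyx : inner ℝ y x = p * lam := by
      obtain ⟨z, hz, rfl⟩ := (G.mem_subdiff_Q_iff hp).1 hy
      rw [real_inner_smul_left, G.inner_of_mem_laplacian hp hz, hQ]
    -- As `mass p x = 1`, this radial correction has zero `massDir`.
    have := hproj (d + (-G.massDir p x d) • x) (by
      rw [G.massDir_add_smul hp, hx1]; ring)
    rw [inner_add_right, real_inner_smul_right, hyx] at this
    linarith

/-! ### Critical points of the Rayleigh quotient -/

theorem clarkeDeriv_R_le {p : ℝ} (hp : 1 ≤ p) {x : Vec N} (hx : x ∈ G.sphere p) (v : Vec N) :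
    clarkeDeriv (G.R p) x v ≤
      ((G.Q p (x + v) - G.Q p x + G.Q p x * (G.mass p (x - v) - G.mass p x) : ℝ) : EReal) := by
  have hx1 := (G.mem_sphere_iff hp x).1 hx
  have hQc := (G.convexOn_Q hp).continuous_vec
  have hgc := (G.convexOn_mass hp).continuous_vec
  -- Convexity replaces increments over a step `t` by `t` times unit-step increments. The resulting
  -- bound is continuous at `(x, 0)`, so the limsup becomes a limit.
  set H : Vec N × ℝ → ℝ := fun q =>
    ((G.Q p (q.1 + v) - G.Q p q.1) * G.mass p q.1 +
      G.Q p q.1 * (G.mass p (q.1 - v) - G.mass p q.1)) /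
      (G.mass p q.1 * G.mass p (q.1 + q.2 • v)) with hH
  have hfil : 𝓝 x ×ˢ 𝓝[>] (0 : ℝ) ≤ 𝓝 (x, (0 : ℝ)) := by
    rw [nhds_prod_eq]; exact Filter.prod_mono le_rfl nhdsWithin_le_nhds
  have hgy : Tendsto (fun q : Vec N × ℝ => G.mass p q.1) (𝓝 (x, (0 : ℝ))) (𝓝 1) := by
    rw [← hx1]; exact (hgc.comp continuous_fst).tendsto _
  have hgz : Tendsto (fun q : Vec N × ℝ => G.mass p (q.1 + q.2 • v)) (𝓝 (x, (0 : ℝ))) (𝓝 1) := by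
    have : Continuous fun q : Vec N × ℝ => G.mass p (q.1 + q.2 • v) := by fun_prop
    have := this.tendsto (x, (0 : ℝ))
    simpa [hx1] using this
  have hHlim : Tendsto H (𝓝 x ×ˢ 𝓝[>] (0 : ℝ))
      (𝓝 (G.Q p (x + v) - G.Q p x + G.Q p x * (G.mass p (x - v) - G.mass p x))) := by
    have hnum : Continuous fun q : Vec N × ℝ => (G.Q p (q.1 + v) - G.Q p q.1) * G.mass p q.1 +
      G.Q p q.1 * (G.mass p (q.1 - v) - G.mass p q.1) := by fun_prop
    have := (hnum.tendsto (x, (0 : ℝ))).div (hgy.mul hgz) (by norm_num)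
    simp only [hx1, mul_one, div_one] at this ⊢
    exact this.mono_left hfil
  have hlim : Tendsto (fun q => (H q : EReal)) (𝓝 x ×ˢ 𝓝[>] (0 : ℝ)) _ :=
    (continuous_coe_real_ereal.tendsto _).comp hHlim
  rw [← hlim.limsup_eq]
  refine limsup_le_limsup ?_
  have hpos : ∀ᶠ t in 𝓝[>] (0 : ℝ), t ∈ Set.Ioo (0 : ℝ) 1 := Ioo_mem_nhdsGT zero_lt_one
  filter_upwards [hfil (hgy.eventually (lt_mem_nhds zero_lt_one)),
    hfil (hgz.eventually (lt_mem_nhds zero_lt_one)), hpos.prod_inr (𝓝 x)] with q h1 h2 ht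
  obtain ⟨y, t⟩ := q
  simp only at h1 h2 ht
  rw [EReal.coe_le_coe_iff, G.R_eq hp, G.R_eq hp, hH]
  simp only
  have hQle : G.Q p (y + t • v) ≤ G.Q p y + t * (G.Q p (y + v) - G.Q p y) := by
    have := (G.convexOn_Q hp).2 (Set.mem_univ y) (Set.mem_univ (y + v))
      (sub_nonneg.2 ht.2.le) ht.1.le (by ring)
    rw [show (1 - t) • y + t • (y + v) = y + t • v by module] at this
    simp only [smul_eq_mul] at this
    linarith
  -- The denominator needs a lower bound on `mass p (y + t • v)`: write `y` as a convex combination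
  -- of `y + t • v` and `y - v`.
  have hgle : G.mass p y * (1 + t) ≤ G.mass p (y + t • v) + t * G.mass p (y - v) := by
    have ht1 : 0 < 1 + t := by linarith [ht.1]
    have := (G.convexOn_mass hp).2 (Set.mem_univ (y + t • v)) (Set.mem_univ (y - v))
      (inv_nonneg.2 ht1.le) (div_nonneg ht.1.le ht1.le) (by field_simp)
    have hy : (1 + t)⁻¹ • (y + t • v) + (t / (1 + t)) • (y - v) = y := by
      match_scalars <;> field_simp
      ring
    rw [hy] at this
    simp only [smul_eq_mul] at this
    have h3 := mul_le_mul_of_nonneg_right this ht1.le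
    refine h3.trans (le_of_eq ?_)
    field_simp
  rw [div_le_iff₀ ht.1, div_sub_div _ _ h2.ne' h1.ne', div_mul_eq_mul_div,
    mul_comm (G.mass p y) (G.mass p (y + t • v))]
  refine div_le_div_of_nonneg_right ?_ (mul_pos h2 h1).le
  have h5 := mul_le_mul_of_nonneg_right hQle h1.le
  have h6 := mul_le_mul_of_nonneg_left hgle (G.Q_nonneg p y)
  linarith

theorem isEigenpair_of_isCriticalR {p : ℝ} (hp : 1 ≤ p) {x : Vec N}
    (h : G.IsCriticalR p x) : G.IsEigenpair p (G.R p x) x := by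
  obtain ⟨hx, hcl⟩ := h
  have hx1 := (G.mem_sphere_iff hp x).1 hx
  have hR : G.R p x = G.Q p x := by rw [G.R_eq hp, hx1, div_one]
  rw [hR, G.isEigenpair_iff hp hx]
  refine ⟨rfl, ?_⟩
  have hv : ∀ v, 0 ≤ G.Q p (x + v) - G.Q p x + G.Q p x * (G.mass p (x - v) - G.mass p x) := by
    intro v
    have := (hcl v).trans (G.clarkeDeriv_R_le hp hx v)
    rwa [inner_zero_left, EReal.coe_le_coe_iff] at this
  have hrefl : ConvexOn ℝ Set.univ fun z => G.mass p ((2 : ℝ) • x - z) := by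
    refine ⟨convex_univ, fun y _ z _ a b ha hb hab => ?_⟩
    have := (G.convexOn_mass hp).2 (Set.mem_univ ((2 : ℝ) • x - y))
      (Set.mem_univ ((2 : ℝ) • x - z)) ha hb hab
    have he : a • ((2 : ℝ) • x - y) + b • ((2 : ℝ) • x - z) =
        (2 : ℝ) • x - (a • y + b • z) := by
      obtain rfl : b = 1 - a := by linarith
      module
    rwa [he] at this
  obtain ⟨y, hy, hy'⟩ := exists_subdiff_neg_subdiff (x := x) (G.convexOn_Q hp)
    (hrefl.smul (G.Q_nonneg p x)) (by
      intro z
      have := hv (z - x)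
      rw [add_sub_cancel, show x - (z - x) = (2 : ℝ) • x - z by module] at this
      simp only [smul_eq_mul, show (2 : ℝ) • x - x = x by module]
      linarith)
  refine ⟨y, hy, fun d => ?_⟩
  have hlim := (G.tendsto_mass_quotient hp x d).const_mul (G.Q p x)
  rw [show p * G.Q p x * G.massDir p x d = G.Q p x * (p * G.massDir p x d) by ring]
  refine ge_of_tendsto hlim ?_
  filter_upwards [self_mem_nhdsWithin] with t (ht : 0 < t)
  -- The reflection through `x` sends this point to `x + t • d`.
  have := hy' (x - t • d)
  simp only [smul_eq_mul, show (2 : ℝ) • x - x = x by module,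
    show (2 : ℝ) • x - (x - t • d) = x + t • d by module,
    show x - t • d - x = -(t • d) by module, inner_neg_left, inner_neg_right, neg_neg,
    real_inner_smul_right] at this
  rw [mul_left_comm, le_inv_mul_iff₀ ht]
  linarith

theorem isCriticalR_of_isEigenpair {p lam : ℝ} (hp : 1 < p) {x : Vec N} (hx : x ∈ G.sphere p)
    (h : G.IsEigenpair p lam x) : G.IsCriticalR p x := by
  have hx1 := (G.mem_sphere_iff hp.le x).1 hx
  obtain ⟨rfl, y, hy, hyd⟩ := (G.isEigenpair_iff hp.le hx).1 h
  refine ⟨hx, fun v => ?_⟩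
  rw [inner_zero_left, clarkeDeriv]
  have hyv : p * G.Q p x * G.massDir p x v ≤ inner ℝ y v := by
    have := hyd (-v)
    rw [G.massDir_neg hp, inner_neg_right] at this
    linarith
  -- For a lower bound on the Clarke derivative it suffices to keep the base point at `x`.
  have hle : pure x ×ˢ 𝓝[>] (0 : ℝ) ≤ 𝓝 x ×ˢ 𝓝[>] (0 : ℝ) :=
    Filter.prod_mono (pure_le_nhds x) le_rfl
  refine le_trans ?_ (limsup_le_limsup_of_le hle)
  rw [pure_prod, limsup, map_map, ← limsup]
  have hm : Tendsto (fun t : ℝ => G.mass p (x + t • v)) (𝓝[>] 0) (𝓝 1) := by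
    have h1 : Tendsto (fun t : ℝ => x + t • v) (𝓝[>] 0) (𝓝 x) := by
      simpa using (tendsto_smul_zero v).const_add x
    have h2 := ((G.convexOn_mass hp.le).continuous_vec.tendsto x).comp h1
    rwa [hx1] at h2
  have hlow : Tendsto (fun t : ℝ => (p * G.Q p x * G.massDir p x v -
      G.Q p x * (t⁻¹ * (G.mass p (x + t • v) - G.mass p x))) / G.mass p (x + t • v))
      (𝓝[>] 0) (𝓝 0) := by
    have := ((((G.tendsto_mass_quotient hp.le x v).const_mul (G.Q p x)).const_sub
      (p * G.Q p x * G.massDir p x v)).div hm one_ne_zero)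
    rw [show p * G.Q p x * G.massDir p x v - G.Q p x * (p * G.massDir p x v) = 0 by ring,
      zero_div] at this
    exact this
  have hlim := (continuous_coe_real_ereal.tendsto _).comp hlow
  rw [← hlim.limsup_eq]
  refine limsup_le_limsup ?_
  filter_upwards [self_mem_nhdsWithin, hm.eventually (lt_mem_nhds zero_lt_one)]
    with t (ht : 0 < t) hmt
  simp only [Function.comp_apply]
  rw [EReal.coe_le_coe_iff, G.R_eq hp.le, G.R_eq hp.le, hx1, div_one]
  have h1 := hy (x + t • v)
  rw [add_sub_cancel_left, real_inner_smul_right] at h1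
  have h2 := mul_le_mul_of_nonneg_left hyv ht.le
  rw [le_div_iff₀ ht, div_sub' hmt.ne', div_mul_eq_mul_div]
  refine div_le_div_of_nonneg_right ?_ hmt.le
  have h3 : t * (t⁻¹ * (G.mass p (x + t • v) - 1)) = G.mass p (x + t • v) - 1 :=
    mul_inv_cancel_left₀ ht.ne' _
  have h4 : (p * G.Q p x * G.massDir p x v -
      G.Q p x * (t⁻¹ * (G.mass p (x + t • v) - 1))) * t = t * (p * G.Q p x * G.massDir p x v) -
      G.Q p x * (t * (t⁻¹ * (G.mass p (x + t • v) - 1))) := by ring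
  rw [h4, h3]
  linarith

end SubmodularHypergraph

/-! ### The counterexample for `p = 1` -/

section PathGraph

/-- A superlevel set of `x` containing `v` contains `u`, so on these sets the cut function agrees
with the modular function of mass `1` at `u` and `-1` at `v`. -/
theorem lovasz_pair_of_le {N : ℕ} {u v : Fin N} {F : Finset (Fin N) → ℝ}
    (hF : ∀ S, F S = if (u ∈ S ↔ v ∈ S) then 0 else 1) {x : Vec N} (hx : x v ≤ x u) :
    lovasz F x = x u - x v := by
  set m : Fin N → ℝ := Pi.single u 1 - Pi.single v 1 with hm
  have hsum : ∀ S : Finset (Fin N),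
      ∑ i ∈ S, m i = (if u ∈ S then 1 else 0) - (if v ∈ S then 1 else 0) := by
    intro S
    simp [hm]
  have h1 := lovaszSum_modular m (by simp [hsum]) x (Tuple.sort fun i => -x i)
  have h2 : ∑ i, m i * x i = x u - x v := by
    simp [hm, sub_mul, Pi.single_apply]
  rw [← h2, ← h1]
  refine lovaszSum_congr fun j hj hne => ?_
  rw [image_Iic_eq_superlevel (antitone_sort_neg x) j hj hne, hF, hsum]
  simp only [Finset.mem_filter, Finset.mem_univ, true_and]
  by_cases hv : x (Tuple.sort (fun i => -x i) j) ≤ x v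
  · simp [hv, hv.trans hx]
  · by_cases hu : x (Tuple.sort (fun i => -x i) j) ≤ x u <;> simp [hu, hv]

theorem lovasz_pair {N : ℕ} {u v : Fin N} {F : Finset (Fin N) → ℝ}
    (hF : ∀ S, F S = if (u ∈ S ↔ v ∈ S) then 0 else 1) (x : Vec N) :
    lovasz F x = |x u - x v| := by
  rcases le_total (x v) (x u) with h | h
  · rw [lovasz_pair_of_le hF h, abs_of_nonneg (sub_nonneg.2 h)]
  · rw [lovasz_pair_of_le (fun S => by rw [hF]; simp only [iff_comm]) h, abs_sub_comm,
      abs_of_nonneg (sub_nonneg.2 h)]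

/-- The weighted path `0 - 1 - 2 - 3`, regarded as a hypergraph. -/
def pathHypergraph : SubmodularHypergraph 4 where
  edges := {{0, 1}, {1, 2}, {2, 3}}
  μ := fun _ => 1
  ϑ := fun e => if e = {1, 2} then 1 else 2
  w := fun e S => if S = ∅ ∨ S = e then 0 else 1
  μ_pos := fun _ => one_pos
  ϑ_pos := fun e _ => by split_ifs <;> norm_num
  w_mem := fun e _ S _ => by split_ifs <;> simp
  w_empty := fun e _ => by simp
  w_symm := fun e _ S hS => by
    have h1 : e \ S = ∅ ↔ S = e := by
      rw [Finset.sdiff_eq_empty_iff_subset]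
      exact ⟨fun h => hS.antisymm h, fun h => h ▸ subset_rfl⟩
    have h2 : e \ S = e ↔ S = ∅ := by
      rw [Finset.sdiff_eq_self_iff_disjoint, disjoint_comm]
      exact ⟨fun h => Finset.disjoint_self_iff_empty S |>.1 (h.mono_right hS), by rintro rfl; simp⟩
    simp only [h1, h2, or_comm]
  w_submodular := fun e _ S hS T hT => by
    by_cases h1 : S = ∅
    · simp [h1]
    by_cases h2 : T = ∅
    · simp [h2]
    by_cases h3 : S = e
    · subst h3; simp [Finset.union_eq_left.2 hT, Finset.inter_eq_right.2 hT]
    by_cases h4 : T = e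
    · subst h4; simp [Finset.union_eq_right.2 hS, Finset.inter_eq_left.2 hS]
    -- Now both sets are nonempty and proper: the right side is `2`, and each term on the left is at
    -- most `1`.
    simp only [h1, h2, h3, h4, or_self, if_false]
    split_ifs <;> norm_num

theorem isProper_pathHypergraph : pathHypergraph.IsProper := by
  have key : ∀ u v : Fin 4, u ≠ v → (∃ S ⊆ ({u, v} : Finset (Fin 4)),
      pathHypergraph.w {u, v} S = 1) ∧
      ∀ k ∈ ({u, v} : Finset (Fin 4)), 0 < pathHypergraph.w {u, v} {k} := by
    intro u v huv
    have h1 : ∀ k : Fin 4, pathHypergraph.w {u, v} {k} = 1 := by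
      intro k
      refine if_neg ?_
      rintro (h | h)
      · simp at h
      · have := congrArg Finset.card h
        rw [Finset.card_pair huv] at this
        simp at this
    exact ⟨⟨{u}, by simp, h1 u⟩, fun k _ => by rw [h1]; exact one_pos⟩
  intro e he
  simp only [pathHypergraph, Finset.mem_insert, Finset.mem_singleton] at he
  rcases he with rfl | rfl | rfl <;> exact key _ _ (by decide)

theorem pathHypergraph_f (u v : Fin 4) (x : Vec 4) :
    pathHypergraph.f {u, v} x = |x u - x v| := by
  refine lovasz_pair (fun S => ?_) x
  have : (S ∩ {u, v} = ∅ ∨ S ∩ {u, v} = {u, v}) ↔ (u ∈ S ↔ v ∈ S) := by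
    rw [Finset.inter_eq_right, Finset.insert_subset_iff, Finset.singleton_subset_iff,
      ← Finset.disjoint_iff_inter_eq_empty, Finset.disjoint_insert_right,
      Finset.disjoint_singleton_right]
    tauto
  simp only [pathHypergraph, this]

theorem pathHypergraph_Q (x : Vec 4) :
    pathHypergraph.Q 1 x = 2 * |x 0 - x 1| + |x 1 - x 2| + 2 * |x 2 - x 3| := by
  have he : pathHypergraph.edges = {{0, 1}, {1, 2}, {2, 3}} := rfl
  have hϑ : ∀ e, pathHypergraph.ϑ e = if e = {1, 2} then 1 else 2 := fun _ => rfl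
  have h1 : pathHypergraph.ϑ {0, 1} = 2 := by rw [hϑ, if_neg (by decide)]
  have h2 : pathHypergraph.ϑ {1, 2} = 1 := by rw [hϑ, if_pos rfl]
  have h3 : pathHypergraph.ϑ {2, 3} = 2 := by rw [hϑ, if_neg (by decide)]
  rw [SubmodularHypergraph.Q, he, Finset.sum_insert (by decide), Finset.sum_insert (by decide),
    Finset.sum_singleton]
  simp only [pathHypergraph_f, Real.rpow_one, h1, h2, h3]
  ring

theorem pathHypergraph_mass (x : Vec 4) :
    pathHypergraph.mass 1 x = |x 0| + |x 1| + |x 2| + |x 3| := by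
  simp [SubmodularHypergraph.mass, pathHypergraph, Fin.sum_univ_four]

/-- An eigenvector of the path which is not critical for its Rayleigh quotient. -/
def pathVector : Vec 4 := !₂[1 / 2, 0, 0, -1 / 2]

theorem pathVector_apply : pathVector 0 = 1 / 2 ∧ pathVector 1 = 0 ∧ pathVector 2 = 0 ∧
    pathVector 3 = -1 / 2 :=
  ⟨rfl, rfl, rfl, rfl⟩

theorem pathVector_mem_sphere : pathVector ∈ pathHypergraph.sphere 1 := by
  rw [pathHypergraph.mem_sphere_iff le_rfl, pathHypergraph_mass]
  simp [pathVector]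
  norm_num [abs_div]

theorem isEigenpair_pathVector : pathHypergraph.IsEigenpair 1 2 pathVector := by
  have hQ : pathHypergraph.Q 1 pathVector = 2 := by
    rw [pathHypergraph_Q]
    norm_num [pathVector_apply, abs_div]
  rw [pathHypergraph.isEigenpair_iff le_rfl pathVector_mem_sphere]
  -- Slope `1` on the outer edges of weight `2`, slope `0` on the tied middle edge; at the two zero
  -- vertices the entries `-2` and `2` lie in `2 * [-1, 1]`.
  refine ⟨hQ, !₂[2, -2, 2, -2], fun z => ?_, fun d => ?_⟩
  · rw [hQ, pathHypergraph_Q, inner_eq_sum, Fin.sum_univ_four]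
    simp [pathVector]
    linarith [le_abs_self (z 0 - z 1), abs_nonneg (z 1 - z 2), le_abs_self (z 2 - z 3)]
  · have hm : pathHypergraph.massDir 1 pathVector d = d 0 + |d 1| + |d 2| - d 3 := by
      simp [SubmodularHypergraph.massDir, pathHypergraph, powDir, absDir, pathVector,
        Fin.sum_univ_four]
      norm_num
      ring
    rw [hm, inner_eq_sum, Fin.sum_univ_four]
    simp
    linarith [neg_abs_le (d 1), le_abs_self (d 2)]

/-- Controls the middle edge against the mass, weighted by the eigenvalue `2`, for all signs of `a`
and `b`: the Clarke derivative ranges over all nearby base points. -/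
theorem abs_sub_increment_le {a b t : ℝ} (ht : 0 < t) :
    |(a + t) - (b - t)| - |a - b| - 2 * ((|a + t| - |a|) + (|b - t| - |b|)) ≤ 2 * t := by
  rcases abs_cases ((a + t) - (b - t)) with h1 | h1 <;> rcases abs_cases (a - b) with h2 | h2 <;>
    rcases abs_cases (a + t) with h3 | h3 <;> rcases abs_cases a with h4 | h4 <;>
    rcases abs_cases (b - t) with h5 | h5 <;> rcases abs_cases b with h6 | h6 <;> linarith

/-- With `ρ = R 1 y` near `2`, the numerator is `ΔQ - ρ Δm = (ΔQ - 2 Δm) + (2 - ρ) Δm ≤ -2t + t`: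
the outer edges lose `4t`, the middle edge minus `2 Δm` gains at most `2t`, and `|Δm| ≤ 2t` with `|ρ
- 2| < 1/2`. Dividing by `t` and by a mass below `2` gives `-1/2`. -/
theorem clarkeDeriv_path_le :
    clarkeDeriv (pathHypergraph.R 1) pathVector !₂[0, 1, -1, 0] ≤ ((-(1 / 2) : ℝ) : EReal) := by
  set d : Vec 4 := !₂[0, 1, -1, 0] with hd
  have hQc := (pathHypergraph.convexOn_Q le_rfl).continuous_vec
  have hgc := (pathHypergraph.convexOn_mass le_rfl).continuous_vec
  have hx1 := (pathHypergraph.mem_sphere_iff le_rfl _).1 pathVector_mem_sphere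
  have hQx : pathHypergraph.Q 1 pathVector = 2 :=
    ((pathHypergraph.isEigenpair_iff le_rfl pathVector_mem_sphere).1 isEigenpair_pathVector).1
  have hcoord : ∀ i : Fin 4, Tendsto (fun y : Vec 4 => y i) (𝓝 pathVector) (𝓝 (pathVector i)) :=
    fun i => (EuclideanSpace.proj (𝕜 := ℝ) i).continuous.tendsto _
  -- With `t < 1/8` these margins keep the signs of both outer differences.
  have e0 : ∀ᶠ y : Vec 4 in 𝓝 pathVector, 1 / 4 < y 0 :=
    (hcoord 0).eventually (lt_mem_nhds (by norm_num [pathVector_apply]))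
  have e1 : ∀ᶠ y : Vec 4 in 𝓝 pathVector, y 1 < 1 / 8 :=
    (hcoord 1).eventually (gt_mem_nhds (by norm_num [pathVector_apply]))
  have e2 : ∀ᶠ y : Vec 4 in 𝓝 pathVector, -(1 / 8) < y 2 :=
    (hcoord 2).eventually (lt_mem_nhds (by norm_num [pathVector_apply]))
  have e3 : ∀ᶠ y : Vec 4 in 𝓝 pathVector, y 3 < -(1 / 4) :=
    (hcoord 3).eventually (gt_mem_nhds (by norm_num [pathVector_apply]))
  have em : ∀ᶠ y : Vec 4 in 𝓝 pathVector, 0 < pathHypergraph.mass 1 y :=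
    (hgc.tendsto _).eventually (lt_mem_nhds (by rw [hx1]; norm_num))
  have eR : ∀ᶠ y : Vec 4 in 𝓝 pathVector,
      |pathHypergraph.Q 1 y / pathHypergraph.mass 1 y - 2| < 1 / 2 := by
    have := (((hQc.tendsto pathVector).div (hgc.tendsto _) (by rw [hx1]; norm_num)).sub_const 2).abs
    exact this.eventually (gt_mem_nhds (by rw [hx1, hQx]; norm_num))
  have em' : ∀ᶠ q : Vec 4 × ℝ in 𝓝 pathVector ×ˢ 𝓝[>] (0 : ℝ),
      0 < pathHypergraph.mass 1 (q.1 + q.2 • d) ∧ pathHypergraph.mass 1 (q.1 + q.2 • d) < 2 := by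
    have hc : Continuous fun q : Vec 4 × ℝ => pathHypergraph.mass 1 (q.1 + q.2 • d) := by fun_prop
    have h0 := hc.tendsto (pathVector, (0 : ℝ))
    simp only [zero_smul, add_zero, hx1] at h0
    have hfil : 𝓝 pathVector ×ˢ 𝓝[>] (0 : ℝ) ≤ 𝓝 (pathVector, (0 : ℝ)) := by
      rw [nhds_prod_eq]; exact Filter.prod_mono le_rfl nhdsWithin_le_nhds
    exact hfil ((h0.eventually (lt_mem_nhds one_pos)).and
      (h0.eventually (gt_mem_nhds one_lt_two)))
  have et : ∀ᶠ t in 𝓝[>] (0 : ℝ), t ∈ Set.Ioo (0 : ℝ) (1 / 8) := Ioo_mem_nhdsGT (by norm_num)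
  refine limsup_le_of_le (h := ?_)
  filter_upwards [(e0.and (e1.and (e2.and (e3.and (em.and eR))))).prod_inl (𝓝[>] (0 : ℝ)), em',
    et.prod_inr (𝓝 pathVector)] with q hq hm ht
  obtain ⟨y, t⟩ := q
  simp only at hq hm ht
  obtain ⟨h0, h1, h2, h3, h4, h5⟩ := hq
  obtain ⟨ht0, ht1⟩ := ht
  rw [EReal.coe_le_coe_iff, pathHypergraph.R_eq le_rfl, pathHypergraph.R_eq le_rfl]
  set ρ := pathHypergraph.Q 1 y / pathHypergraph.mass 1 y with hρ
  have hQρ : pathHypergraph.Q 1 y = ρ * pathHypergraph.mass 1 y := by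
    rw [hρ, div_mul_cancel₀ _ h4.ne']
  have hQ' : pathHypergraph.Q 1 (y + t • d) - pathHypergraph.Q 1 y =
      -(4 * t) + (|(y 1 + t) - (y 2 - t)| - |y 1 - y 2|) := by
    rw [pathHypergraph_Q, pathHypergraph_Q]
    simp only [PiLp.add_apply, PiLp.smul_apply, hd, smul_eq_mul]
    simp only [Fin.isValue, Matrix.cons_val, mul_zero, add_zero, mul_one, mul_neg]
    rw [abs_of_pos (show 0 < y 0 - (y 1 + t) by linarith),
      abs_of_pos (show 0 < y 0 - y 1 by linarith),
      abs_of_pos (show 0 < y 2 + -t - y 3 by linarith),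
      abs_of_pos (show 0 < y 2 - y 3 by linarith)]
    ring_nf
  have hg' : pathHypergraph.mass 1 (y + t • d) - pathHypergraph.mass 1 y =
      (|y 1 + t| - |y 1|) + (|y 2 - t| - |y 2|) := by
    rw [pathHypergraph_mass, pathHypergraph_mass]
    simp only [PiLp.add_apply, PiLp.smul_apply, hd, smul_eq_mul]
    simp only [Fin.isValue, Matrix.cons_val, mul_zero, add_zero, mul_one, mul_neg]
    ring_nf
  have hinc := abs_sub_increment_le (a := y 1) (b := y 2) ht0
  rw [← hg'] at hinc
  have hΔ : |pathHypergraph.mass 1 (y + t • d) - pathHypergraph.mass 1 y| ≤ 2 * t := by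
    rw [hg']
    have h6 := abs_abs_sub_abs_le_abs_sub (y 1 + t) (y 1)
    have h7 := abs_abs_sub_abs_le_abs_sub (y 2 - t) (y 2)
    rw [add_sub_cancel_left, abs_of_pos ht0] at h6
    rw [sub_sub_cancel_left, abs_neg, abs_of_pos ht0] at h7
    exact (abs_add_le _ _).trans (by linarith)
  have hprod : (2 - ρ) * (pathHypergraph.mass 1 (y + t • d) - pathHypergraph.mass 1 y) ≤ t := by
    refine (le_abs_self _).trans ?_
    rw [abs_mul, abs_sub_comm]
    calc _ ≤ 1 / 2 * (2 * t) := mul_le_mul h5.le hΔ (abs_nonneg _) (by norm_num)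
      _ = t := by ring
  rw [div_le_iff₀ ht0, div_sub' hm.1.ne', div_le_iff₀ hm.1]
  have h8 := mul_le_mul_of_nonneg_left hm.2.le ht0.le
  nlinarith

theorem not_isCriticalR_pathVector : ¬ pathHypergraph.IsCriticalR 1 pathVector := by
  rintro ⟨_, h⟩
  have := (h _).trans clarkeDeriv_path_le
  rw [inner_zero_left, EReal.coe_le_coe_iff] at this
  norm_num at this

end PathGraph

end

theorem theorem1 :
    (∀ (N : ℕ) (G : SubmodularHypergraph N) (p lam : ℝ) (x : Vec N), 1 ≤ p → x ∈ G.sphere p →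
      (G.IsEigenpair p lam x ↔ G.IsCriticalQ p x ∧ G.Q p x = lam)) ∧
    (∀ (N : ℕ) (G : SubmodularHypergraph N) (p lam : ℝ) (x : Vec N), 1 < p → x ∈ G.sphere p →
      (G.IsEigenpair p lam x ↔ G.IsCriticalR p x ∧ G.R p x = lam)) ∧
    (∀ (N : ℕ) (G : SubmodularHypergraph N) (lam : ℝ) (x : Vec N), x ∈ G.sphere 1 →
      G.IsCriticalR 1 x → G.R 1 x = lam → G.IsEigenpair 1 lam x) ∧
    (∃ (N : ℕ) (G : SubmodularHypergraph N) (lam : ℝ) (x : Vec N), G.IsProper ∧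
      x ∈ G.sphere 1 ∧ G.IsEigenpair 1 lam x ∧ ¬ G.IsCriticalR 1 x) := by
  refine ⟨fun N G p lam x hp hx => G.isEigenpair_iff_isCriticalQ hp hx,
    fun N G p lam x hp hx => ⟨fun h => ⟨G.isCriticalR_of_isEigenpair hp hx h, ?_⟩, ?_⟩, ?_,
    4, pathHypergraph, 2, pathVector, isProper_pathHypergraph, pathVector_mem_sphere,
    isEigenpair_pathVector, not_isCriticalR_pathVector⟩
  · rw [G.R_eq hp.le, (G.mem_sphere_iff hp.le x).1 hx, div_one]
    exact ((G.isEigenpair_iff hp.le hx).1 h).1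
  · rintro ⟨h, rfl⟩
    exact G.isEigenpair_of_isCriticalR hp.le h
  · rintro N G lam x _ h rfl
    exact G.isEigenpair_of_isCriticalR le_rfl h
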